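/- Let $L>0$. For $\varepsilon>0$ let $\lambda_0^\varepsilon<\lambda_1^\varepsilon<\lambda_2^\varepsilon<\cdots$ be the eigenvalues, in increasing order, of the operator $$\mathcal L^\varepsilon u=-\partial_x\Bigl(\tanh\Bigl(\frac{x}{2\varepsilon}\Bigr)u\Bigr)-\varepsilon\,\partial_x^2u$$ acting on $H^1_0\cap H^2(-L,L)$, and put $\mu_k^\varepsilon=\lambda_k^\varepsilon-\frac1{4\varepsilon}$ for $k\ge0$. (i) For all $\varepsilon>0$ and $\widetilde T>0$ there is a family $(q_k^\varepsilon)_{k\ge1}$ in $L^2\bigl(-\frac{\widetilde T}2,\frac{\widetilde T}2\bigr)$ such that $$\int_{-\widetilde T/2}^{\widetilde T/2}e^{\mu_j^\varepsilon t}\,q_k^\varepsilon(t)\,\mathrm dt=\delta_{j,k}\qquad\text{for all } j\ge0,\ k\ge1. \tag{1}$$ (ii) Moreover, there is a rational function $c=c(\varepsilon,\kappa,L,\widetilde T)$ with real coefficients, whose denominator has no zero in $\{\varepsilon>0,\ \kappa>1,\ L>0,\ \widetilde T>0\}$, such that for all $\varepsilon>0$, $\kappa>1$, $L>0$ and $\widetilde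 T>0$ there is a family $(q_k^\varepsilon)_{k\ge1}$ in $L^2\bigl(-\frac{\widetilde T}2,\frac{\widetilde T}2\bigr)$ satisfying (1) and $$\|q_k^\varepsilon\|_{L^2(-\widetilde T/2,\widetilde T/2)}\le c(\varepsilon,\kappa,L,\widetilde T)\,\frac1{\mu_k^\varepsilon}\,e^{\frac{3\kappa L^2}{\varepsilon\widetilde T}}\qquad\text{for all } k\ge1.$$ -/

import Mathlib

namespace BurgersShock

open MeasureTheory Set

noncomputable section

/-- The linearized Burgers operator `𝓛^ε u = -∂ₓ(tanh(x/(2ε)) u) - ε ∂ₓ² u`. -/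
def linOp (ε : ℝ) (u : ℝ → ℝ) (x : ℝ) : ℝ :=
  -deriv (fun y => Real.tanh (y / (2 * ε)) * u y) x - ε * deriv (deriv u) x

/-- `u ∈ H¹₀ ∩ H²(-L, L)`, for the continuous representative of the class on `[-L, L]`:
`u` is continuously differentiable on `[-L, L]`, its derivative `v` is absolutely continuous,
the (almost everywhere defined) second derivative is square integrable, and `u` vanishes at
both end points. -/
def MemH10H2 (L : ℝ) (u : ℝ → ℝ) : Prop :=
  (∃ v : ℝ → ℝ,
    (∀ x ∈ Icc (-L) L, HasDerivWithinAt u (v x) (Icc (-L) L) x) ∧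
    AbsolutelyContinuousOnInterval v (-L) L ∧
    MemLp (deriv v) 2 (volume.restrict (Ioo (-L) L))) ∧
  u (-L) = 0 ∧ u L = 0

/-- `lam` is an eigenvalue of `𝓛^ε` acting on `H¹₀ ∩ H²(-L, L)`. -/
def IsEigenvalue (ε L lam : ℝ) : Prop :=
  ∃ u : ℝ → ℝ, MemH10H2 L u ∧ (∃ x ∈ Ioo (-L) L, u x ≠ 0) ∧
    ∀ᵐ x ∂(volume.restrict (Ioo (-L) L)), linOp ε u x = lam * u x

/-- The eigenvalues `λ₀ < λ₁ < λ₂ < …` of `𝓛^ε` on `H¹₀ ∩ H²(-L, L)`, in increasing order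
(they are simple, so this is also the enumeration with multiplicity). -/
def eigenval (ε L : ℝ) : ℕ → ℝ
  | 0 => sInf {lam | IsEigenvalue ε L lam}
  | k + 1 => sInf {lam | IsEigenvalue ε L lam ∧ eigenval ε L k < lam}

/-- The shifted eigenvalues `μ_k = λ_k - 1/(4ε)`. -/
def shiftedEigenval (ε L : ℝ) (k : ℕ) : ℝ :=
  eigenval ε L k - 1 / (4 * ε)

/-- The space `L²(-T/2, T/2)`. -/
abbrev L2Sym (T : ℝ) : Type :=
  Lp ℝ 2 (volume.restrict (Ioo (-(T / 2)) (T / 2)))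

/-- `(q_k)_{k ≥ 1}` is biorthogonal to `(e^{μ_j t})_{j ≥ 0}` on `(-T/2, T/2)`; the entry `q 0`
plays no role. -/
def IsBiorthogonal (ε L T : ℝ) (q : ℕ → L2Sym T) : Prop :=
  ∀ j k : ℕ, 1 ≤ k →
    ∫ t in Ioo (-(T / 2)) (T / 2), Real.exp (shiftedEigenval ε L j * t) * q k t
      = if j = k then 1 else 0

end

end BurgersShock

/-!
Multiplication by `cosh (x / 2ε)` turns `𝓛^ε` into a Pöschl–Teller operator, whose eigenfunctions
are elementary (a Darboux transform of sines and cosines). The eigenvalue equations can therefore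
be solved one by one: `μ_k = c x_k²` with `c = π² ε / (4 L²)` and `k < x_k < k + 1`, uniformly in
`ε`, while `μ_0` is bounded by `1 / (4ε) + c`.

A function with prescribed moments against `e^{μ_j t}`, `j ≤ N`, is obtained by applying the
Lagrange basis polynomial of the nodes `μ_j`, evaluated at `-d/dt`, to the Gevrey bump
`exp (-ν / (1 - (t / β)²))`. On the imaginary axis this polynomial is dominated, uniformly in `N`,
by a sine product which grows like `exp (π √(τ / 2c))`, and a suitable `ν` makes the Fourier
transform of the bump decay `√κ` times as fast. The limit `N → ∞` is a weak compactness argument.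
-/

namespace BurgersShock

open MeasureTheory Set
open scoped FourierTransform ContDiff

noncomputable section

section SecondOrderODE

/-- `w`, with derivative `w'`, solves the linear equation `w'' = Q w` on the set `s`. -/
structure IsODESolution (Q : ℝ → ℝ) (s : Set ℝ) (w w' : ℝ → ℝ) : Prop where
  hasDerivWithinAt : ∀ x ∈ s, HasDerivWithinAt w (w' x) s x
  hasDerivWithinAt_deriv : ∀ x ∈ s, HasDerivWithinAt w' (Q x * w x) s x

/-- The Dirichlet problem `w'' = Q w`, `w (-L) = w L = 0` has a nontrivial solution. -/
def HasDirichletSolution (Q : ℝ → ℝ) (L : ℝ) : Prop :=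
  ∃ w w' : ℝ → ℝ, IsODESolution Q (Icc (-L) L) w w' ∧ w (-L) = 0 ∧ w L = 0 ∧
    ∃ x ∈ Ioo (-L) L, w x ≠ 0

/-- The Wronskian of two functions `v`, `w` with given derivatives `v'`, `w'`. -/
def wronskian (v v' w w' : ℝ → ℝ) (x : ℝ) : ℝ := v x * w' x - v' x * w x

variable {Q v v' w w' : ℝ → ℝ} {s t : Set ℝ} {a b c x y L : ℝ}

namespace IsODESolution

theorem comp_mul_const (h : IsODESolution Q s w w') (hst : MapsTo (fun x => x * c) t s) :
    IsODESolution (fun x => c ^ 2 * Q (x * c)) t (fun x => w (x * c))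
      (fun x => c * w' (x * c)) where
  hasDerivWithinAt x hx :=
    ((h.hasDerivWithinAt _ (hst hx)).comp x (hasDerivAt_mul_const c).hasDerivWithinAt
      hst).congr_deriv (mul_comm _ _)
  hasDerivWithinAt_deriv x hx :=
    (((h.hasDerivWithinAt_deriv _ (hst hx)).comp x (hasDerivAt_mul_const c).hasDerivWithinAt
      hst).const_mul c).congr_deriv (by ring)

theorem wronskian_eq (hs : Convex ℝ s) (hv : IsODESolution Q s v v')
    (hw : IsODESolution Q s w w') (hx : x ∈ s) (hy : y ∈ s) :
    wronskian v v' w w' x = wronskian v v' w w' y := by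
  have hd : ∀ z ∈ s, HasDerivWithinAt (wronskian v v' w w') 0 s z := fun z hz =>
    (((hv.hasDerivWithinAt z hz).mul (hw.hasDerivWithinAt_deriv z hz)).sub
      ((hv.hasDerivWithinAt_deriv z hz).mul (hw.hasDerivWithinAt z hz))).congr_deriv (by ring)
  simpa [sub_eq_zero] using
    hs.norm_image_sub_le_of_norm_hasDerivWithin_le (C := 0) hd (by simp) hy hx

theorem exists_ne_zero_of_wronskian_ne_zero (hv : IsODESolution Q (Icc a b) v v')
    (hx : x ∈ Ioo a b) (hne : wronskian v v' w w' x ≠ 0) : ∃ y ∈ Ioo a b, v y ≠ 0 := by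
  by_contra! hzero
  have hloc : v =ᶠ[nhds x] fun _ => 0 := Filter.eventually_of_mem (Ioo_mem_nhds hx.1 hx.2) hzero
  have hderiv : v' x = 0 :=
    ((hv.hasDerivWithinAt x (Ioo_subset_Icc_self hx)).hasDerivAt
      (Icc_mem_nhds hx.1 hx.2)).unique ((hasDerivAt_const x 0).congr_of_eventuallyEq hloc)
  exact hne (by rw [wronskian, hzero x hx, hderiv, zero_mul, zero_mul, sub_zero])

-- Sturm: the quotient `w / v` has derivative `W / v ^ 2` with a constant Wronskian `W`, which
-- vanishes by Rolle's theorem.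
theorem eq_zero_of_pos (hv : IsODESolution Q (Icc a b) v v') (hpos : ∀ x ∈ Icc a b, 0 < v x)
    (hw : IsODESolution Q (Icc a b) w w') (ha : w a = 0) (hb : w b = 0) (hx : x ∈ Ioo a b) :
    w x = 0 := by
  have hab : a < b := hx.1.trans hx.2
  have hleft : a ∈ Icc a b := left_mem_Icc.2 hab.le
  have hd : ∀ y ∈ Icc a b, HasDerivWithinAt (fun z => w z / v z)
      (wronskian v v' w w' a / v y ^ 2) (Icc a b) y := fun y hy =>
    ((hw.hasDerivWithinAt y hy).div (hv.hasDerivWithinAt y hy) (hpos y hy).ne').congr_deriv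
      (by rw [hv.wronskian_eq (convex_Icc a b) hw hleft hy, wronskian]; ring)
  obtain ⟨y, hy, hy0⟩ := exists_hasDerivAt_eq_zero hab
    (fun y hy => (hd y hy).continuousWithinAt) (by simp only [ha, hb, zero_div])
    (fun y hy => (hd y (Ioo_subset_Icc_self hy)).hasDerivAt (Icc_mem_nhds hy.1 hy.2))
  have hW : wronskian v v' w w' a = 0 :=
    (div_eq_zero_iff.1 hy0).resolve_right (pow_pos (hpos y (Ioo_subset_Icc_self hy)) 2).ne'
  have hquot : w x / v x = w a / v a := by
    simpa [sub_eq_zero] using (convex_Icc a b).norm_image_sub_le_of_norm_hasDerivWithin_le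
      (C := 0) hd (by simp [hW]) hleft (Ioo_subset_Icc_self hx)
  rw [ha, zero_div] at hquot
  exact (div_eq_zero_iff.1 hquot).resolve_right (hpos x (Ioo_subset_Icc_self hx)).ne'

end IsODESolution

theorem HasDirichletSolution.comp_mul_const (h : HasDirichletSolution Q (L * c)) (hc : 0 < c) :
    HasDirichletSolution (fun x => c ^ 2 * Q (x * c)) L := by
  obtain ⟨w, w', hw, hl, hr, x, hx, hne⟩ := h
  have hmaps : MapsTo (fun y => y * c) (Icc (-L) L) (Icc (-(L * c)) (L * c)) := fun y hy =>
    ⟨by rw [← neg_mul]; exact mul_le_mul_of_nonneg_right hy.1 hc.le,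
      mul_le_mul_of_nonneg_right hy.2 hc.le⟩
  refine ⟨_, _, hw.comp_mul_const hmaps, by rwa [neg_mul], hr, x / c, ?_, ?_⟩
  · rwa [mem_Ioo, lt_div_iff₀ hc, div_lt_iff₀ hc, neg_mul]
  · rwa [div_mul_cancel₀ _ hc.ne']

theorem hasDirichletSolution_comp_mul_const_iff (hc : 0 < c) :
    HasDirichletSolution (fun x => c ^ 2 * Q (x * c)) L ↔ HasDirichletSolution Q (L * c) := by
  refine ⟨fun h => ?_, fun h => h.comp_mul_const hc⟩
  rw [← mul_inv_cancel_right₀ hc.ne' L] at h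
  convert h.comp_mul_const (inv_pos.2 hc) using 2 with x
  field_simp

theorem not_hasDirichletSolution_of_pos (hv : IsODESolution Q (Icc (-L) L) v v')
    (hpos : ∀ x ∈ Icc (-L) L, 0 < v x) : ¬ HasDirichletSolution Q L := by
  rintro ⟨w, w', hw, hl, hr, x, hx, hne⟩
  exact hne (hv.eq_zero_of_pos hpos hw hl hr hx)

theorem hasDirichletSolution_iff_of_even_odd (hL : 0 < L)
    (hv : IsODESolution Q (Icc (-L) L) v v') (hw : IsODESolution Q (Icc (-L) L) w w')
    (heven : v (-L) = v L) (hodd : w (-L) = -w L) (hne : wronskian v v' w w' 0 ≠ 0) :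
    HasDirichletSolution Q L ↔ v L = 0 ∨ w L = 0 := by
  have h0 : (0 : ℝ) ∈ Ioo (-L) L := ⟨neg_lt_zero.2 hL, hL⟩
  have hleft : -L ∈ Icc (-L) L := left_mem_Icc.2 (by linarith)
  have hright : L ∈ Icc (-L) L := right_mem_Icc.2 (by linarith)
  constructor
  · rintro ⟨f, f', hf, hfl, hfr, x, hx, hfx⟩
    by_contra! hvw
    have hconv : Convex ℝ (Icc (-L) L) := convex_Icc _ _
    have hbd : ∀ g g' : ℝ → ℝ, IsODESolution Q (Icc (-L) L) g g' →
        g (-L) * f' (-L) = g L * f' L ∧ wronskian g g' f f' x = g L * f' L := fun g g' hg => by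
      simpa [wronskian, hfl, hfr] using And.intro (hg.wronskian_eq hconv hf hleft hright)
        (hg.wronskian_eq hconv hf (Ioo_subset_Icc_self hx) hright)
    obtain ⟨hvf, hvfx⟩ := hbd v v' hv
    obtain ⟨hwf, hwfx⟩ := hbd w w' hw
    have heq : f' (-L) = f' L := mul_left_cancel₀ hvw.1 (heven ▸ hvf)
    have hneg : -f' (-L) = f' L := mul_left_cancel₀ hvw.2 (by rw [← hwf, hodd]; ring)
    have hfL : f' L = 0 := by linarith
    rw [hfL, mul_zero, wronskian] at hvfx hwfx
    rw [hv.wronskian_eq hconv hw (Ioo_subset_Icc_self h0) (Ioo_subset_Icc_self hx),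
      wronskian] at hne
    exact hfx ((mul_eq_zero.1 (by linear_combination w x * hvfx - v x * hwfx :
      (v x * w' x - v' x * w x) * f x = 0)).resolve_left hne)
  · rintro (hvL | hwL)
    · exact ⟨v, v', hv, heven.trans hvL, hvL, hv.exists_ne_zero_of_wronskian_ne_zero h0 hne⟩
    · refine ⟨w, w', hw, by rw [hodd, hwL, neg_zero], hwL,
        hw.exists_ne_zero_of_wronskian_ne_zero h0 (w := v) (w' := v') ?_⟩
      rw [wronskian] at hne ⊢
      contrapose! hne
      linarith

end SecondOrderODE

section Gauge

theorem hasDerivAt_tanh (x : ℝ) : HasDerivAt Real.tanh (1 - Real.tanh x ^ 2) x := by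
  have hc : Real.cosh x ≠ 0 := (Real.cosh_pos x).ne'
  rw [show Real.tanh = Real.sinh / Real.cosh from funext Real.tanh_eq_sinh_div_cosh]
  refine ((Real.hasDerivAt_sinh x).div (Real.hasDerivAt_cosh x) hc).congr_deriv ?_
  simp only [Pi.div_apply]
  field_simp

theorem hasDerivAt_tanh_div (c x : ℝ) :
    HasDerivAt (fun y => Real.tanh (y / c)) ((1 - Real.tanh (x / c) ^ 2) / c) x := by
  refine ((hasDerivAt_tanh (x / c)).comp x ((hasDerivAt_id x).div_const c)).congr_deriv ?_
  rw [mul_one_div]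

theorem hasDerivAt_cosh_div (c x : ℝ) :
    HasDerivAt (fun y => Real.cosh (y / c)) (Real.tanh (x / c) * Real.cosh (x / c) / c) x := by
  refine ((Real.hasDerivAt_cosh (x / c)).comp x
    ((hasDerivAt_id x).div_const c)).congr_deriv ?_
  rw [Real.tanh_eq_sinh_div_cosh, div_mul_cancel₀ _ (Real.cosh_pos _).ne', mul_one_div]

theorem continuous_tanh_div (c : ℝ) : Continuous fun x : ℝ => Real.tanh (x / c) :=
  continuous_iff_continuousAt.2 fun x => (hasDerivAt_tanh_div c x).continuousAt

variable {ε L lam a b : ℝ} {u v g : ℝ → ℝ}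

/-- The value of `u''` which `𝓛^ε u = lam u` prescribes in terms of `u` and its derivative `v`. -/
def secondDeriv (ε lam : ℝ) (u v : ℝ → ℝ) (x : ℝ) : ℝ :=
  -((1 - Real.tanh (x / (2 * ε)) ^ 2) / (2 * ε) * u x + Real.tanh (x / (2 * ε)) * v x
    + lam * u x) / ε

/-- `u`, with derivative `v`, is a nontrivial twice differentiable Dirichlet eigenfunction of
`𝓛^ε` on `[-L, L]`. -/
structure IsClassicalEigenfunction (ε L lam : ℝ) (u v : ℝ → ℝ) : Prop where
  hasDerivWithinAt : ∀ x ∈ Icc (-L) L, HasDerivWithinAt u (v x) (Icc (-L) L) x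
  hasDerivWithinAt_deriv : ∀ x ∈ Icc (-L) L,
    HasDerivWithinAt v (secondDeriv ε lam u v x) (Icc (-L) L) x
  left_eq_zero : u (-L) = 0
  right_eq_zero : u L = 0
  exists_ne_zero : ∃ x ∈ Ioo (-L) L, u x ≠ 0

theorem continuousOn_secondDeriv {s : Set ℝ} (ε lam : ℝ) (hu : ContinuousOn u s)
    (hv : ContinuousOn v s) : ContinuousOn (secondDeriv ε lam u v) s := by
  have ht := (continuous_tanh_div (2 * ε)).continuousOn (s := s)
  unfold secondDeriv
  fun_prop

theorem linOp_eq_mul_iff (hε : ε ≠ 0)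
    (hu : ∀ x ∈ Icc a b, HasDerivWithinAt u (v x) (Icc a b) x) {x : ℝ} (hx : x ∈ Ioo a b) :
    linOp ε u x = lam * u x ↔ deriv v x = secondDeriv ε lam u v x := by
  have hloc : ∀ᶠ y in nhds x, HasDerivAt u (v y) y := by
    filter_upwards [Ioo_mem_nhds hx.1 hx.2] with y hy
    exact (hu y (Ioo_subset_Icc_self hy)).hasDerivAt (Icc_mem_nhds hy.1 hy.2)
  have hdd : deriv (deriv u) x = deriv v x :=
    Filter.EventuallyEq.deriv_eq (hloc.mono fun y hy => hy.deriv)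
  rw [linOp, hdd, ((hasDerivAt_tanh_div (2 * ε) x).fun_mul hloc.self_of_nhds).deriv, secondDeriv,
    eq_div_iff hε]
  constructor <;> intro h <;> linarith

theorem hasDerivWithinAt_of_ae_deriv_eq (hv : AbsolutelyContinuousOnInterval v a b)
    (hg : ContinuousOn g (Icc a b))
    (h : ∀ᵐ x ∂(volume.restrict (Ioo a b)), deriv v x = g x) {x : ℝ} (hx : x ∈ Icc a b) :
    HasDerivWithinAt v (g x) (Icc a b) x := by
  have hab : a ≤ b := hx.1.trans hx.2
  have hint : ∀ y ∈ Icc a b, v y = v a + ∫ t in a..y, g t := by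
    intro y hy
    have hftc := (hv.mono (by rw [uIcc_of_le hy.1, uIcc_of_le hab]
                              exact Icc_subset_Icc_right hy.2)).integral_deriv_eq_sub
    have hcongr : ∫ t in a..y, deriv v t = ∫ t in a..y, g t := by
      rw [intervalIntegral.integral_of_le hy.1, intervalIntegral.integral_of_le hy.1,
        integral_Ioc_eq_integral_Ioo, integral_Ioc_eq_integral_Ioo]
      exact integral_congr_ae
        (ae_restrict_of_ae_restrict_of_subset (Ioo_subset_Ioo_right hy.2) h)
    linarith
  have hgi : IntervalIntegrable g volume a x :=
    (hg.mono (by rw [uIcc_of_le hx.1]; exact Icc_subset_Icc_right hx.2)).intervalIntegrable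
  have : Fact (x ∈ Icc a b) := ⟨hx⟩
  exact ((intervalIntegral.integral_hasDerivWithinAt_right hgi
    (hg.stronglyMeasurableAtFilter_nhdsWithin measurableSet_Icc x) (hg x hx)).const_add
      (v a)).congr hint (hint x hx)

theorem absolutelyContinuousOnInterval_of_hasDerivWithinAt (hab : a ≤ b)
    (hg : ContinuousOn g (Icc a b)) (hv : ∀ x ∈ Icc a b, HasDerivWithinAt v (g x) (Icc a b) x) :
    AbsolutelyContinuousOnInterval v a b := by
  obtain ⟨C, hC⟩ := isCompact_Icc.exists_bound_of_continuousOn hg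
  have hlip : LipschitzOnWith C.toNNReal v (Icc a b) :=
    (convex_Icc a b).lipschitzOnWith_of_nnnorm_hasDerivWithin_le hv fun x hx => by
      rw [← NNReal.coe_le_coe, coe_nnnorm]
      exact (hC x hx).trans (Real.le_coe_toNNReal C)
  rw [← uIcc_of_le hab] at hlip
  exact hlip.absolutelyContinuousOnInterval

theorem memLp_two_deriv_of_hasDerivWithinAt (hg : ContinuousOn g (Icc a b))
    (hv : ∀ x ∈ Icc a b, HasDerivWithinAt v (g x) (Icc a b) x) :
    MemLp (deriv v) 2 (volume.restrict (Ioo a b)) := by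
  obtain ⟨C, hC⟩ := isCompact_Icc.exists_bound_of_continuousOn hg
  refine MemLp.of_bound (stronglyMeasurable_deriv v).aestronglyMeasurable C ?_
  filter_upwards [ae_restrict_mem measurableSet_Ioo] with x hx
  rw [((hv x (Ioo_subset_Icc_self hx)).hasDerivAt (Icc_mem_nhds hx.1 hx.2)).deriv]
  exact hC x (Ioo_subset_Icc_self hx)

theorem IsEigenvalue.exists_isClassicalEigenfunction (hε : ε ≠ 0) (h : IsEigenvalue ε L lam) :
    ∃ u v, IsClassicalEigenfunction ε L lam u v := by
  obtain ⟨u, ⟨⟨v, huv, hac, -⟩, hl, hr⟩, hne, heq⟩ := h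
  have hL : -L ≤ L := by
    obtain ⟨x, hx, -⟩ := hne
    exact (hx.1.trans hx.2).le
  have hg : ContinuousOn (secondDeriv ε lam u v) (Icc (-L) L) :=
    continuousOn_secondDeriv ε lam (fun x hx => (huv x hx).continuousWithinAt)
      (by simpa only [uIcc_of_le hL] using hac.continuousOn)
  refine ⟨u, v, huv, fun x hx => hasDerivWithinAt_of_ae_deriv_eq hac hg ?_ hx, hl, hr, hne⟩
  filter_upwards [heq, ae_restrict_mem measurableSet_Ioo] with y hy hyI
  exact (linOp_eq_mul_iff hε huv hyI).1 hy

theorem IsClassicalEigenfunction.isEigenvalue (hε : ε ≠ 0)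
    (h : IsClassicalEigenfunction ε L lam u v) : IsEigenvalue ε L lam := by
  have hL : -L ≤ L := by
    obtain ⟨x, hx, -⟩ := h.exists_ne_zero
    exact (hx.1.trans hx.2).le
  have hg : ContinuousOn (secondDeriv ε lam u v) (Icc (-L) L) :=
    continuousOn_secondDeriv ε lam (fun x hx => (h.hasDerivWithinAt x hx).continuousWithinAt)
      (fun x hx => (h.hasDerivWithinAt_deriv x hx).continuousWithinAt)
  refine ⟨u, ⟨⟨v, h.hasDerivWithinAt, absolutelyContinuousOnInterval_of_hasDerivWithinAt hL hg
    h.hasDerivWithinAt_deriv, memLp_two_deriv_of_hasDerivWithinAt hg h.hasDerivWithinAt_deriv⟩,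
    h.left_eq_zero, h.right_eq_zero⟩, h.exists_ne_zero, ?_⟩
  filter_upwards [ae_restrict_mem measurableSet_Ioo] with x hx
  exact (linOp_eq_mul_iff hε h.hasDerivWithinAt hx).2
    ((h.hasDerivWithinAt_deriv x (Ioo_subset_Icc_self hx)).hasDerivAt
      (Icc_mem_nhds hx.1 hx.2)).deriv

/-- The coefficient of the Pöschl–Teller equation `w'' = -(2 / cosh² + p) w`. -/
def poschlTeller (p y : ℝ) : ℝ := -(2 * (1 - Real.tanh y ^ 2) + p)

theorem IsClassicalEigenfunction.hasDirichletSolution (hε : ε ≠ 0)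
    (h : IsClassicalEigenfunction ε L lam u v) :
    HasDirichletSolution
      (fun x => (2 * ε)⁻¹ ^ 2 * poschlTeller (4 * ε * lam - 1) (x * (2 * ε)⁻¹)) L := by
  obtain ⟨x₀, hx₀, hne⟩ := h.exists_ne_zero
  refine ⟨fun x => u x * Real.cosh (x / (2 * ε)), fun x => v x * Real.cosh (x / (2 * ε)) +
      u x * (Real.tanh (x / (2 * ε)) * Real.cosh (x / (2 * ε)) / (2 * ε)),
    ⟨fun x hx => (h.hasDerivWithinAt x hx).mul (hasDerivAt_cosh_div _ x).hasDerivWithinAt,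
      fun x hx => ?_⟩, by simp [h.left_eq_zero], by simp [h.right_eq_zero],
    x₀, hx₀, mul_ne_zero hne (Real.cosh_pos _).ne'⟩
  have hc := (hasDerivAt_cosh_div (2 * ε) x).hasDerivWithinAt (s := Icc (-L) L)
  have ht := (hasDerivAt_tanh_div (2 * ε) x).hasDerivWithinAt (s := Icc (-L) L)
  refine (((h.hasDerivWithinAt_deriv x hx).mul hc).add
    ((h.hasDerivWithinAt x hx).mul ((ht.mul hc).div_const (2 * ε)))).congr_deriv ?_
  simp only [secondDeriv, poschlTeller, Pi.mul_apply, ← div_eq_mul_inv]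
  field_simp
  ring

theorem exists_isClassicalEigenfunction_of_hasDirichletSolution (hε : ε ≠ 0)
    (h : HasDirichletSolution
      (fun x => (2 * ε)⁻¹ ^ 2 * poschlTeller (4 * ε * lam - 1) (x * (2 * ε)⁻¹)) L) :
    ∃ u v, IsClassicalEigenfunction ε L lam u v := by
  obtain ⟨w, w', hw, hl, hr, x₀, hx₀, hne⟩ := h
  have hcosh : ∀ x, Real.cosh (x / (2 * ε)) ≠ 0 := fun x => (Real.cosh_pos _).ne'
  have hc := fun x => (hasDerivAt_cosh_div (2 * ε) x).hasDerivWithinAt (s := Icc (-L) L)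
  have ht := fun x => (hasDerivAt_tanh_div (2 * ε) x).hasDerivWithinAt (s := Icc (-L) L)
  refine ⟨fun x => w x / Real.cosh (x / (2 * ε)), fun x =>
      (w' x - Real.tanh (x / (2 * ε)) / (2 * ε) * w x) / Real.cosh (x / (2 * ε)),
    fun x hx => ?_, fun x hx => ?_, by simp [hl], by simp [hr],
    x₀, hx₀, div_ne_zero hne (hcosh x₀)⟩
  · refine ((hw.hasDerivWithinAt x hx).div (hc x) (hcosh x)).congr_deriv ?_
    field_simp [hcosh x]
  · refine (((hw.hasDerivWithinAt_deriv x hx).sub (((ht x).div_const (2 * ε)).mul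
      (hw.hasDerivWithinAt x hx))).div (hc x) (hcosh x)).congr_deriv ?_
    simp only [secondDeriv, poschlTeller, Pi.sub_apply, Pi.mul_apply, ← div_eq_mul_inv]
    field_simp [hcosh x]
    ring

theorem isEigenvalue_iff_hasDirichletSolution (hε : 0 < ε) :
    IsEigenvalue ε L lam ↔
      HasDirichletSolution (poschlTeller (4 * ε * lam - 1)) (L / (2 * ε)) := by
  rw [div_eq_mul_inv, ← hasDirichletSolution_comp_mul_const_iff (by positivity)]
  constructor
  · intro h
    obtain ⟨u, v, huv⟩ := h.exists_isClassicalEigenfunction hε.ne'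
    exact huv.hasDirichletSolution hε.ne'
  · intro h
    obtain ⟨u, v, huv⟩ := exists_isClassicalEigenfunction_of_hasDirichletSolution hε.ne' h
    exact huv.isEigenvalue hε.ne'

end Gauge

section PoschlTeller

/-- `C` and `S` are the cosine- and sine-like solutions of `y'' = -p y`. -/
structure IsTrigPair (p : ℝ) (C S : ℝ → ℝ) : Prop where
  hasDerivAt_S : ∀ y, HasDerivAt S (C y) y
  hasDerivAt_C : ∀ y, HasDerivAt C (-p * S y) y
  sq_add_sq : ∀ y, C y ^ 2 + p * S y ^ 2 = 1
  S_neg : ∀ y, S (-y) = -S y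
  C_neg : ∀ y, C (-y) = C y

/-- The even solution of the Pöschl–Teller equation, obtained from `-S` by the Darboux
transformation `y ↦ y' - tanh * y`. -/
def evenSol (C S : ℝ → ℝ) (y : ℝ) : ℝ := C y - Real.tanh y * S y

/-- The derivative of `evenSol`. -/
def evenSolDeriv (p : ℝ) (C S : ℝ → ℝ) (y : ℝ) : ℝ :=
  -p * S y - ((1 - Real.tanh y ^ 2) * S y + Real.tanh y * C y)

/-- The odd solution of the Pöschl–Teller equation, obtained from `-C` by the Darboux
transformation `y ↦ y' - tanh * y`. -/
def oddSol (p : ℝ) (C S : ℝ → ℝ) (y : ℝ) : ℝ := p * S y + Real.tanh y * C y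

/-- The derivative of `oddSol`. -/
def oddSolDeriv (p : ℝ) (C S : ℝ → ℝ) (y : ℝ) : ℝ :=
  p * C y + ((1 - Real.tanh y ^ 2) * C y + Real.tanh y * (-p * S y))

namespace IsTrigPair

variable {p l : ℝ} {C S : ℝ → ℝ}

theorem isODESolution_evenSol (h : IsTrigPair p C S) (s : Set ℝ) :
    IsODESolution (poschlTeller p) s (evenSol C S) (evenSolDeriv p C S) where
  hasDerivWithinAt y _ := ((h.hasDerivAt_C y).sub
    ((hasDerivAt_tanh y).mul (h.hasDerivAt_S y))).hasDerivWithinAt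
  hasDerivWithinAt_deriv y _ := by
    have ht := hasDerivAt_tanh y
    refine ((((h.hasDerivAt_S y).const_mul (-p)).sub
      ((((ht.pow 2).const_sub 1).mul (h.hasDerivAt_S y)).add
        (ht.mul (h.hasDerivAt_C y)))).congr_deriv ?_).hasDerivWithinAt
    simp only [poschlTeller, evenSol, Pi.pow_apply]
    push_cast
    ring

theorem isODESolution_oddSol (h : IsTrigPair p C S) (s : Set ℝ) :
    IsODESolution (poschlTeller p) s (oddSol p C S) (oddSolDeriv p C S) where
  hasDerivWithinAt y _ := (((h.hasDerivAt_S y).const_mul p).add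
    ((hasDerivAt_tanh y).mul (h.hasDerivAt_C y))).hasDerivWithinAt
  hasDerivWithinAt_deriv y _ := by
    have ht := hasDerivAt_tanh y
    refine ((((h.hasDerivAt_C y).const_mul p).add
      ((((ht.pow 2).const_sub 1).mul (h.hasDerivAt_C y)).add
        (ht.mul ((h.hasDerivAt_S y).const_mul (-p))))).congr_deriv ?_).hasDerivWithinAt
    simp only [poschlTeller, oddSol, Pi.pow_apply]
    push_cast
    ring

theorem wronskian_evenSol_oddSol (h : IsTrigPair p C S) (y : ℝ) :
    wronskian (evenSol C S) (evenSolDeriv p C S) (oddSol p C S) (oddSolDeriv p C S) y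
      = 1 + p := by
  simp only [wronskian, evenSol, oddSol, evenSolDeriv, oddSolDeriv]
  linear_combination (1 + p) * h.sq_add_sq y

theorem hasDirichletSolution_iff (h : IsTrigPair p C S) (hp : p ≠ -1) (hl : 0 < l) :
    HasDirichletSolution (poschlTeller p) l ↔
      C l - Real.tanh l * S l = 0 ∨ p * S l + Real.tanh l * C l = 0 :=
  hasDirichletSolution_iff_of_even_odd hl (h.isODESolution_evenSol _) (h.isODESolution_oddSol _)
    (by simp only [evenSol, Real.tanh_neg, h.S_neg, h.C_neg, neg_mul_neg])
    (by simp only [oddSol, Real.tanh_neg, h.S_neg, h.C_neg]; ring)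
    (by rw [h.wronskian_evenSol_oddSol]; contrapose! hp; linarith)

end IsTrigPair

theorem isTrigPair_cos {s : ℝ} (hs : s ≠ 0) :
    IsTrigPair (s ^ 2) (fun y => Real.cos (y * s)) (fun y => Real.sin (y * s) / s) where
  hasDerivAt_S y := by
    refine (((Real.hasDerivAt_sin _).comp y (hasDerivAt_mul_const s)).div_const s).congr_deriv ?_
    field_simp
  hasDerivAt_C y := by
    refine ((Real.hasDerivAt_cos _).comp y (hasDerivAt_mul_const s)).congr_deriv ?_
    field_simp
  sq_add_sq y := by
    field_simp
    exact Real.cos_sq_add_sin_sq _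
  S_neg y := by simp [neg_div]
  C_neg y := by simp

theorem isTrigPair_cosh {s : ℝ} (hs : s ≠ 0) :
    IsTrigPair (-s ^ 2) (fun y => Real.cosh (y * s)) (fun y => Real.sinh (y * s) / s) where
  hasDerivAt_S y := by
    refine (((Real.hasDerivAt_sinh _).comp y
      (hasDerivAt_mul_const s)).div_const s).congr_deriv ?_
    field_simp
  hasDerivAt_C y := by
    refine ((Real.hasDerivAt_cosh _).comp y (hasDerivAt_mul_const s)).congr_deriv ?_
    field_simp
  sq_add_sq y := by
    field_simp
    exact Real.cosh_sq_sub_sinh_sq _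
  S_neg y := by simp [neg_div]
  C_neg y := by simp

theorem isTrigPair_zero : IsTrigPair 0 (fun _ => 1) (fun y => y) where
  hasDerivAt_S y := hasDerivAt_id y
  hasDerivAt_C y := by simpa using hasDerivAt_const y (1 : ℝ)
  sq_add_sq y := by simp
  S_neg y := rfl
  C_neg _ := rfl

theorem not_hasDirichletSolution_of_one_le {s : ℝ} (hs : 1 ≤ s) (l : ℝ) :
    ¬ HasDirichletSolution (poschlTeller (-s ^ 2)) l := by
  have h := isTrigPair_cosh (s := s) (by positivity)
  refine not_hasDirichletSolution_of_pos (h.isODESolution_evenSol _) fun y _ => ?_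
  have hsinh : |Real.sinh (y * s)| < Real.cosh (y * s) := by
    refine abs_lt_of_sq_lt_sq ?_ (Real.cosh_pos _).le
    linarith [Real.cosh_sq (y * s)]
  have hprod : |Real.tanh y * (Real.sinh (y * s) / s)| ≤ |Real.sinh (y * s)| := by
    rw [abs_mul, abs_div, abs_of_pos (by linarith : 0 < s)]
    exact (mul_le_of_le_one_left (by positivity) (Real.abs_tanh_lt_one y).le).trans
      (div_le_self (abs_nonneg _) hs)
  rw [evenSol, sub_pos]
  exact (le_abs_self _).trans_lt (hprod.trans_lt hsinh)

end PoschlTeller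

section Phases

/-- The phase function whose levels at the multiples of `π / 2` give the positive levels of the
Pöschl–Teller equation. -/
def phase (m θ : ℝ) : ℝ := θ - Real.arctan (θ / m)

/-- The function whose positive zero gives the negative level of the Pöschl–Teller equation. -/
def hypPhase (m φ : ℝ) : ℝ := φ / m - Real.tanh φ

variable {f f' : ℝ → ℝ} {v x y : ℝ}

theorem exists_zero_Ioo_of_deriv_neg {b : ℝ} (hc : Continuous f) (h0 : f 0 = 0)
    (hderiv : deriv f 0 < 0) (hb : 0 < b) (hfb : 0 < f b) : ∃ x ∈ Ioo 0 b, f x = 0 := by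
  have hsign : ∀ᶠ x in nhdsWithin 0 (Ioi 0), f x < 0 := by
    filter_upwards [nhdsWithin_le_nhds (eventually_nhdsWithin_sign_eq_of_deriv_neg hderiv h0),
      self_mem_nhdsWithin] with x hx hx0
    rwa [zero_sub, sign_neg (neg_lt_zero.2 hx0), sign_eq_neg_one_iff] at hx
  obtain ⟨a, hfa, ha⟩ := (hsign.and (Ioo_mem_nhdsGT hb)).exists
  obtain ⟨x, hx, hx0⟩ := intermediate_value_Ioo ha.2.le hc.continuousOn ⟨hfa, hfb⟩
  exact ⟨x, ⟨ha.1.trans hx.1, hx.2⟩, hx0⟩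

theorem pos_of_hasDerivAt_pos (hf : ∀ x, HasDerivAt f (f' x) x) (h0 : f 0 = 0)
    (hpos : ∀ x, 0 < x → 0 < f' x) (hx : 0 < x) : 0 < f x := by
  have hmono : StrictMonoOn f (Ici 0) :=
    strictMonoOn_of_deriv_pos (convex_Ici 0)
      (fun x _ => (hf x).continuousAt.continuousWithinAt) fun a ha => by
        rw [(hf a).deriv]
        exact hpos a (by rwa [interior_Ici] at ha)
  exact h0 ▸ hmono self_mem_Ici hx.le hx

theorem strictConvexOn_Ici_of_hasDerivAt (hf : ∀ x, HasDerivAt f (f' x) x)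
    (hmono : StrictMonoOn f' (Ioi 0)) : StrictConvexOn ℝ (Ici 0) f := by
  refine StrictMonoOn.strictConvexOn_of_deriv (convex_Ici 0)
    (fun x _ => (hf x).continuousAt.continuousWithinAt) ?_
  rwa [interior_Ici, show deriv f = f' from funext fun x => (hf x).deriv]

theorem eq_of_strictConvexOn_of_eq_level (hf : StrictConvexOn ℝ (Ici 0) f) (h0 : f 0 ≤ v)
    (hx : 0 < x) (hy : 0 < y) (hfx : f x = v) (hfy : f y = v) : x = y := by
  by_contra hne
  wlog hxy : x < y generalizing x y
  · exact this hy hx hfy hfx (Ne.symm hne) ((Ne.lt_or_gt hne).resolve_left hxy)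
  have hlt := hf.secant_strict_mono (a := x) hx.le self_mem_Ici hy.le hx.ne hxy.ne' hy
  rw [hfx, hfy, sub_self, zero_div] at hlt
  exact hlt.not_ge (div_nonneg_of_nonpos (by linarith) (by linarith))

theorem tanh_strictMono : StrictMono Real.tanh := by
  refine strictMono_of_deriv_pos fun x => ?_
  rw [(hasDerivAt_tanh x).deriv, sub_pos]
  exact Real.tanh_sq_lt_one x

theorem tanh_pos (hx : 0 < x) : 0 < Real.tanh x := Real.tanh_zero ▸ tanh_strictMono hx

variable {m θ φ θ' : ℝ} {j k : ℕ}

theorem hasDerivAt_phase (hm : 0 < m) (θ : ℝ) :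
    HasDerivAt (phase m) (1 - m / (m ^ 2 + θ ^ 2)) θ := by
  refine ((hasDerivAt_id θ).sub ((hasDerivAt_id θ).div_const m).arctan).congr_deriv ?_
  simp only [id]
  field_simp

theorem continuous_phase (m : ℝ) : Continuous (phase m) := by
  unfold phase
  fun_prop

theorem phase_zero (m : ℝ) : phase m 0 = 0 := by simp [phase]

theorem strictConvexOn_phase (hm : 0 < m) : StrictConvexOn ℝ (Ici 0) (phase m) := by
  refine strictConvexOn_Ici_of_hasDerivAt (hasDerivAt_phase hm) fun a ha b _ hab => ?_
  have ha' : (0 : ℝ) < a := ha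
  gcongr

theorem phase_eq_unique (hm : 0 < m) (hθ : 0 < θ) (hθ' : 0 < θ')
    (h : phase m θ = k * (Real.pi / 2)) (h' : phase m θ' = k * (Real.pi / 2)) : θ = θ' :=
  eq_of_strictConvexOn_of_eq_level (strictConvexOn_phase hm)
    (by rw [phase_zero]; positivity) hθ hθ' h h'

theorem lt_one_of_phase_eq_zero (hθ : 0 < θ) (h : phase m θ = 0) : m < 1 := by
  by_contra! hm
  refine h.not_gt (pos_of_hasDerivAt_pos (hasDerivAt_phase (by linarith)) (phase_zero m)
    (fun x hx => ?_) hθ)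
  rw [sub_pos, div_lt_one (by positivity)]
  nlinarith

theorem phase_lt (hm : 0 < m) (hθ : 0 < θ) : phase m θ < θ :=
  sub_lt_self _ (Real.arctan_pos.2 (by positivity))

theorem sub_pi_div_two_lt_phase (m θ : ℝ) : θ - Real.pi / 2 < phase m θ :=
  sub_lt_sub_left (Real.arctan_lt_pi_div_two _) θ

theorem exists_phase_eq_zero (hm0 : 0 < m) (hm : m < 1) : ∃ θ, 0 < θ ∧ phase m θ = 0 := by
  have hderiv : deriv (phase m) 0 < 0 := by
    rw [(hasDerivAt_phase hm0 0).deriv, sub_neg, one_lt_div (by positivity)]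
    nlinarith
  obtain ⟨θ, hθ, h0⟩ := exists_zero_Ioo_of_deriv_neg (continuous_phase m) (phase_zero m) hderiv
    Real.pi_div_two_pos (by linarith [sub_pi_div_two_lt_phase m (Real.pi / 2)])
  exact ⟨θ, hθ.1, h0⟩

theorem exists_phase_eq (hm : 0 < m) (hk : 1 ≤ k) :
    ∃ θ, 0 < θ ∧ phase m θ = k * (Real.pi / 2) := by
  have : (0 : ℝ) < k := by exact_mod_cast hk
  have hpi := Real.pi_pos
  have hlo := phase_lt hm (θ := k * (Real.pi / 2)) (by positivity)
  have hhi := sub_pi_div_two_lt_phase m ((k + 1) * (Real.pi / 2))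
  obtain ⟨x, hx, hx0⟩ := intermediate_value_Icc
    (show k * (Real.pi / 2) ≤ (k + 1) * (Real.pi / 2) by nlinarith)
    (continuous_phase m).continuousOn ⟨hlo.le, by linarith⟩
  exact ⟨x, lt_of_lt_of_le (by positivity) hx.1, hx0⟩

theorem phase_level_gap (hm : 0 < m) (hjk : j < k) (hθ : 0 < θ) (hθ' : 0 < θ')
    (h : phase m θ = j * (Real.pi / 2)) (h' : phase m θ' = k * (Real.pi / 2)) :
    (k - j) * (Real.pi / 2) ≤ θ' - θ := by
  have hle : θ ≤ θ' := by
    have h1 := sub_pi_div_two_lt_phase m θ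
    have h2 := phase_lt hm hθ'
    have h3 : (j : ℝ) + 1 ≤ k := by exact_mod_cast hjk
    nlinarith [Real.pi_pos]
  have harctan : Real.arctan (θ / m) ≤ Real.arctan (θ' / m) :=
    Real.arctan_strictMono.monotone (by gcongr)
  rw [phase] at h h'
  linarith

theorem hasDerivAt_hypPhase (m φ : ℝ) :
    HasDerivAt (hypPhase m) (1 / m - (1 - Real.tanh φ ^ 2)) φ :=
  ((hasDerivAt_id φ).div_const m).sub (hasDerivAt_tanh φ)

theorem hypPhase_zero (m : ℝ) : hypPhase m 0 = 0 := by simp [hypPhase]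

theorem strictConvexOn_hypPhase (m : ℝ) : StrictConvexOn ℝ (Ici 0) (hypPhase m) := by
  refine strictConvexOn_Ici_of_hasDerivAt (hasDerivAt_hypPhase m) fun a ha b _ hab => ?_
  have hpos := (tanh_pos ha).le
  have hlt := tanh_strictMono hab
  gcongr

theorem hypPhase_eq_zero_unique {φ' : ℝ} (hφ : 0 < φ) (hφ' : 0 < φ') (h : hypPhase m φ = 0)
    (h' : hypPhase m φ' = 0) : φ = φ' :=
  eq_of_strictConvexOn_of_eq_level (strictConvexOn_hypPhase m) (hypPhase_zero m).le hφ hφ' h h'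

theorem one_lt_of_hypPhase_eq_zero (hm0 : 0 < m) (hφ : 0 < φ) (h : hypPhase m φ = 0) :
    1 < m := by
  by_contra! hm
  refine h.not_gt (pos_of_hasDerivAt_pos (hasDerivAt_hypPhase m) (hypPhase_zero m)
    (fun x hx => ?_) hφ)
  have h1 := one_le_one_div hm0 hm
  have h2 := tanh_pos hx
  nlinarith

theorem exists_hypPhase_eq_zero {l : ℝ} (hl : 0 < l) (hm : 1 < l * Real.tanh l) :
    ∃ φ ∈ Ioo 0 l, hypPhase (l * Real.tanh l) φ = 0 := by
  have hm0 : 0 < l * Real.tanh l := one_pos.trans hm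
  have hderiv : deriv (hypPhase (l * Real.tanh l)) 0 < 0 := by
    rw [(hasDerivAt_hypPhase _ 0).deriv, Real.tanh_zero]
    have := (div_lt_one hm0).2 hm
    linarith
  have hend : 0 < hypPhase (l * Real.tanh l) l := by
    rw [hypPhase, sub_pos, lt_div_iff₀ hm0, mul_left_comm, ← sq]
    exact mul_lt_of_lt_one_right hl (Real.tanh_sq_lt_one l)
  exact exists_zero_Ioo_of_deriv_neg (continuous_iff_continuousAt.2 fun x =>
    (hasDerivAt_hypPhase _ x).continuousAt) (hypPhase_zero _) hderiv hl hend

end Phases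

section Levels

variable {l m θ φ p p' : ℝ} {j k : ℕ}

theorem sin_sub_arctan (θ x : ℝ) :
    Real.sin (θ - Real.arctan x) = (Real.sin θ - x * Real.cos θ) / √(1 + x ^ 2) := by
  rw [Real.sin_sub, Real.cos_arctan, Real.sin_arctan]
  ring

theorem cos_sub_arctan (θ x : ℝ) :
    Real.cos (θ - Real.arctan x) = (Real.cos θ + x * Real.sin θ) / √(1 + x ^ 2) := by
  rw [Real.cos_sub, Real.cos_arctan, Real.sin_arctan]
  ring

theorem sin_phase_eq_zero_or_cos_phase_eq_zero_iff (hθ : 0 < θ) :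
    Real.sin (phase m θ) = 0 ∨ Real.cos (phase m θ) = 0 ↔
      ∃ k : ℕ, phase m θ = k * (Real.pi / 2) := by
  have htwo : Real.sin (phase m θ) = 0 ∨ Real.cos (phase m θ) = 0 ↔
      Real.sin (2 * phase m θ) = 0 := by simp [Real.sin_two_mul]
  rw [htwo, Real.sin_eq_zero_iff]
  constructor
  · rintro ⟨n, hn⟩
    have hn0 : -1 < n := by
      by_contra! hc
      have : (n : ℝ) ≤ -1 := by exact_mod_cast hc
      nlinarith [Real.pi_pos, sub_pi_div_two_lt_phase m θ]
    lift n to ℕ using by omega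
    refine ⟨n, ?_⟩
    push_cast at hn
    linarith
  · rintro ⟨k, hk⟩
    exact ⟨k, by push_cast; linarith⟩

theorem hasDirichletSolution_sq_iff (hl : 0 < l) (hθ : 0 < θ) :
    HasDirichletSolution (poschlTeller ((θ / l) ^ 2)) l ↔
      ∃ k : ℕ, phase (l * Real.tanh l) θ = k * (Real.pi / 2) := by
  have ht := tanh_pos hl
  have hp : (θ / l) ^ 2 ≠ -1 := ne_of_gt (neg_one_lt_zero.trans_le (sq_nonneg _))
  rw [← sin_phase_eq_zero_or_cos_phase_eq_zero_iff hθ, phase, sin_sub_arctan, cos_sub_arctan,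
    (isTrigPair_cos (by positivity)).hasDirichletSolution_iff hp hl,
    mul_div_cancel₀ _ hl.ne', div_eq_zero_iff, div_eq_zero_iff]
  have hroot : √(1 + (θ / (l * Real.tanh l)) ^ 2) ≠ 0 := by positivity
  simp only [hroot, or_false]
  field_simp
  refine or_congr ?_ ?_ <;> constructor <;> intro h <;> linarith

theorem hasDirichletSolution_zero_iff (hl : 0 < l) :
    HasDirichletSolution (poschlTeller 0) l ↔ l * Real.tanh l = 1 := by
  rw [isTrigPair_zero.hasDirichletSolution_iff (by norm_num) hl, zero_mul, zero_add, mul_one,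
    or_iff_left (tanh_pos hl).ne', sub_eq_zero, mul_comm, eq_comm]

theorem hasDirichletSolution_neg_sq_iff (hφ : 0 < φ) (hφl : φ < l) :
    HasDirichletSolution (poschlTeller (-(φ / l) ^ 2)) l ↔ hypPhase (l * Real.tanh l) φ = 0 := by
  have hl := hφ.trans hφl
  have hs : φ / l < 1 := (div_lt_one hl).2 hφl
  have ht := tanh_pos hl
  have htφ := tanh_pos hφ
  have hodd : -(φ / l) ^ 2 * (Real.sinh φ / (φ / l)) + Real.tanh l * Real.cosh φ ≠ 0 := by
    have hlt : φ / l * Real.tanh φ < Real.tanh l :=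
      (mul_lt_of_lt_one_left htφ hs).trans (tanh_strictMono hφl)
    rw [Real.tanh_eq_sinh_div_cosh, ← mul_div_assoc, div_lt_iff₀ (Real.cosh_pos φ)] at hlt
    refine ne_of_gt ?_
    convert sub_pos.2 hlt using 1
    field_simp
    ring
  have hp : -(φ / l) ^ 2 ≠ -1 := by
    have : (φ / l) ^ 2 < 1 := (sq_lt_one_iff₀ (by positivity)).2 hs
    linarith
  rw [(isTrigPair_cosh (by positivity)).hasDirichletSolution_iff hp hl,
    mul_div_cancel₀ _ hl.ne', or_iff_left hodd, hypPhase, Real.tanh_eq_sinh_div_cosh φ]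
  have := Real.cosh_pos φ
  field_simp
  constructor <;> intro h <;> linarith

/-- `IsLevel l k p` says that `p` is the `k`-th level of the Pöschl–Teller equation on `[-l, l]`.
Only the lowest level can fail to be positive. -/
inductive IsLevel (l : ℝ) : ℕ → ℝ → Prop
  | trig {k : ℕ} {θ : ℝ} (hθ : 0 < θ) (h : phase (l * Real.tanh l) θ = k * (Real.pi / 2)) :
      IsLevel l k ((θ / l) ^ 2)
  | zero (h : l * Real.tanh l = 1) : IsLevel l 0 0
  | hyp {φ : ℝ} (hφ : 0 < φ) (hφl : φ < l) (h : hypPhase (l * Real.tanh l) φ = 0) :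
      IsLevel l 0 (-(φ / l) ^ 2)

theorem exists_isLevel (hl : 0 < l) (k : ℕ) : ∃ p, IsLevel l k p := by
  have hm : 0 < l * Real.tanh l := mul_pos hl (tanh_pos hl)
  rcases Nat.eq_zero_or_pos k with rfl | hk
  · rcases lt_trichotomy (l * Real.tanh l) 1 with h | h | h
    · obtain ⟨θ, hθ, h0⟩ := exists_phase_eq_zero hm h
      exact ⟨_, .trig hθ (by simpa using h0)⟩
    · exact ⟨_, .zero h⟩
    · obtain ⟨φ, hφ, h0⟩ := exists_hypPhase_eq_zero hl h
      exact ⟨_, .hyp hφ.1 hφ.2 h0⟩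
  · obtain ⟨θ, hθ, h⟩ := exists_phase_eq hm hk
    exact ⟨_, .trig hθ h⟩

theorem hasDirichletSolution_iff_exists_isLevel (hl : 0 < l) :
    HasDirichletSolution (poschlTeller p) l ↔ ∃ k, IsLevel l k p := by
  constructor
  · intro h
    rcases lt_trichotomy p 0 with hp | rfl | hp
    · have hps : -(l * √(-p) / l) ^ 2 = p := by
        rw [mul_div_cancel_left₀ _ hl.ne', Real.sq_sqrt (by linarith), neg_neg]
      have hroot : √(-p) < 1 := by
        by_contra! hge
        refine not_hasDirichletSolution_of_one_le hge l ?_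
        rwa [Real.sq_sqrt (by linarith), neg_neg]
      have hφ : 0 < l * √(-p) := mul_pos hl (Real.sqrt_pos.2 (by linarith))
      have hφl : l * √(-p) < l := mul_lt_of_lt_one_right hl hroot
      rw [← hps] at h ⊢
      exact ⟨0, .hyp hφ hφl ((hasDirichletSolution_neg_sq_iff hφ hφl).1 h)⟩
    · exact ⟨0, .zero ((hasDirichletSolution_zero_iff hl).1 h)⟩
    · have hps : (l * √p / l) ^ 2 = p := by
        rw [mul_div_cancel_left₀ _ hl.ne', Real.sq_sqrt hp.le]
      have hθ : 0 < l * √p := mul_pos hl (Real.sqrt_pos.2 hp)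
      rw [← hps] at h ⊢
      obtain ⟨k, hk⟩ := (hasDirichletSolution_sq_iff hl hθ).1 h
      exact ⟨k, .trig hθ hk⟩
  · rintro ⟨k, hk⟩
    cases hk with
    | trig hθ h => exact (hasDirichletSolution_sq_iff hl hθ).2 ⟨k, h⟩
    | zero h => exact (hasDirichletSolution_zero_iff hl).2 h
    | hyp hφ hφl h => exact (hasDirichletSolution_neg_sq_iff hφ hφl).2 h

namespace IsLevel

theorem unique (hl : 0 < l) (hp : IsLevel l k p) (hp' : IsLevel l k p') : p = p' := by
  have hm : 0 < l * Real.tanh l := mul_pos hl (tanh_pos hl)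
  have lt_one {θ} (hθ : 0 < θ) (h : phase (l * Real.tanh l) θ = (0 : ℕ) * (Real.pi / 2)) :
      l * Real.tanh l < 1 := lt_one_of_phase_eq_zero hθ (by simpa using h)
  rcases hp with ⟨hθ, h⟩ | h | ⟨hφ, hφl, h⟩ <;> rcases hp' with ⟨hθ', h'⟩ | h' | ⟨hφ', hφl', h'⟩
  · rw [phase_eq_unique hm hθ hθ' h h']
  · linarith [lt_one hθ h]
  · linarith [lt_one hθ h, one_lt_of_hypPhase_eq_zero hm hφ' h']
  · linarith [lt_one hθ' h']
  · rfl
  · linarith [one_lt_of_hypPhase_eq_zero hm hφ' h']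
  · linarith [lt_one hθ' h', one_lt_of_hypPhase_eq_zero hm hφ h]
  · linarith [one_lt_of_hypPhase_eq_zero hm hφ h]
  · rw [hypPhase_eq_zero_unique hφ hφ' h h']

theorem exists_phase (hp : IsLevel l k p) (hk : 1 ≤ k) :
    ∃ θ, 0 < θ ∧ phase (l * Real.tanh l) θ = k * (Real.pi / 2) ∧ p = (θ / l) ^ 2 := by
  cases hp with
  | trig hθ h => exact ⟨_, hθ, h, rfl⟩
  | zero => omega
  | hyp => omega

theorem neg_one_lt (hp : IsLevel l k p) : -1 < p := by
  cases hp with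
  | trig => exact neg_one_lt_zero.trans_le (sq_nonneg _)
  | zero => exact neg_one_lt_zero
  | hyp hφ hφl =>
    exact neg_lt_neg ((sq_lt_one_iff₀ (div_pos hφ (hφ.trans hφl)).le).2
      ((div_lt_one (hφ.trans hφl)).2 hφl))

theorem lt_sq (hl : 0 < l) (hp : IsLevel l 0 p) : p < (Real.pi / 2 / l) ^ 2 := by
  have hpos : 0 < (Real.pi / 2 / l) ^ 2 := by positivity
  cases hp with
  | @trig _ θ hθ h =>
    have hθ' : θ < Real.pi / 2 := by
      have := sub_pi_div_two_lt_phase (l * Real.tanh l) θ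
      rw [h, Nat.cast_zero, zero_mul] at this
      linarith
    gcongr
  | zero => exact hpos
  | hyp => exact (neg_nonpos.2 (sq_nonneg _)).trans_lt hpos

theorem sq_le_sub (hl : 0 < l) (hjk : j < k) (hp : IsLevel l j p) (hp' : IsLevel l k p') :
    (Real.pi / 2 / l) ^ 2 ≤ p' - p := by
  have hm : 0 < l * Real.tanh l := mul_pos hl (tanh_pos hl)
  obtain ⟨θ', hθ', h', rfl⟩ := hp'.exists_phase (by omega)
  have of_nonpos {q : ℝ} (hq : q ≤ 0) : (Real.pi / 2 / l) ^ 2 ≤ (θ' / l) ^ 2 - q := by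
    have hk : (1 : ℝ) ≤ k := by exact_mod_cast (by omega : 1 ≤ k)
    have hθ'k : Real.pi / 2 ≤ θ' := by nlinarith [phase_lt hm hθ', Real.pi_pos]
    have : (Real.pi / 2 / l) ^ 2 ≤ (θ' / l) ^ 2 := by gcongr
    linarith
  cases hp with
  | @trig _ θ hθ h =>
    have hgap := phase_level_gap hm hjk hθ hθ' h h'
    have hjk' : (1 : ℝ) ≤ k - j := by
      rw [le_sub_iff_add_le']
      exact_mod_cast hjk
    have hθθ' : Real.pi / 2 ≤ θ' - θ := by nlinarith [Real.pi_pos]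
    rw [div_pow, div_pow θ', div_pow θ, ← sub_div]
    gcongr
    nlinarith [Real.pi_pos]
  | zero => exact of_nonpos le_rfl
  | hyp => exact of_nonpos (neg_nonpos.2 (sq_nonneg _))

end IsLevel

end Levels

section Spectrum

variable {ε L : ℝ}

theorem eigenval_eq_of_strictMono {f : ℕ → ℝ} (hf : StrictMono f)
    (h : ∀ lam, IsEigenvalue ε L lam ↔ ∃ k, f k = lam) (k : ℕ) : eigenval ε L k = f k := by
  induction k with
  | zero =>
    refine IsLeast.csInf_eq ⟨(h _).2 ⟨0, rfl⟩, ?_⟩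
    rintro lam hlam
    obtain ⟨j, rfl⟩ := (h lam).1 hlam
    exact hf.monotone j.zero_le
  | succ k ih =>
    rw [eigenval, ih]
    refine IsLeast.csInf_eq ⟨⟨(h _).2 ⟨k + 1, rfl⟩, hf k.lt_succ_self⟩, ?_⟩
    rintro lam ⟨hlam, hlt⟩
    obtain ⟨j, rfl⟩ := (h lam).1 hlam
    exact hf.monotone (hf.lt_iff_lt.1 hlt)

theorem isLevel_shiftedEigenval (hε : 0 < ε) (hL : 0 < L) (k : ℕ) :
    IsLevel (L / (2 * ε)) k (4 * ε * shiftedEigenval ε L k) := by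
  have hl : 0 < L / (2 * ε) := by positivity
  choose p hp using exists_isLevel hl
  have hmono : StrictMono fun k => (p k + 1) / (4 * ε) := by
    intro j k hjk
    have := IsLevel.sq_le_sub hl hjk (hp j) (hp k)
    have : 0 < (Real.pi / 2 / (L / (2 * ε))) ^ 2 := by positivity
    have : p j < p k := by linarith
    dsimp only
    gcongr
  have hspec (lam : ℝ) : IsEigenvalue ε L lam ↔ ∃ k, (p k + 1) / (4 * ε) = lam := by
    rw [isEigenvalue_iff_hasDirichletSolution hε, hasDirichletSolution_iff_exists_isLevel hl]
    refine exists_congr fun k => ⟨fun h => ?_, ?_⟩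
    · rw [(hp k).unique hl h]
      field_simp
      ring
    · rintro rfl
      convert hp k using 1
      field_simp
      ring
  rw [shiftedEigenval, eigenval_eq_of_strictMono hmono hspec]
  convert hp k using 1
  field_simp
  ring

/-- Sequences `μ` that grow like the Dirichlet spectrum `c k²`: from `k = 1` on,
`μ k = c (x k)²` with well-separated `x k`. The entry `μ 0` may be negative. -/
structure QuadraticSpectrum (c : ℝ) (x μ : ℕ → ℝ) : Prop where
  lt_root : ∀ {k : ℕ}, 1 ≤ k → (k : ℝ) < x k
  root_lt : ∀ {k : ℕ}, 1 ≤ k → x k < k + 1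
  sub_le_sub_root : ∀ {j k : ℕ}, 1 ≤ j → j ≤ k → (k : ℝ) - j ≤ x k - x j
  eq_mul_sq : ∀ {k : ℕ}, 1 ≤ k → μ k = c * x k ^ 2
  le_sub_zero : ∀ {k : ℕ}, 1 ≤ k → c ≤ μ k - μ 0

/-- The constant `c = π² ε / (4 L²)` for which the eigenvalues grow like `c k²`. -/
def gapConst (ε L : ℝ) : ℝ := Real.pi ^ 2 * ε / (4 * L ^ 2)

theorem gapConst_pos (hε : 0 < ε) (hL : 0 < L) : 0 < gapConst ε L := by
  unfold gapConst
  positivity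

theorem four_mul_gapConst (hε : 0 < ε) :
    4 * ε * gapConst ε L = (Real.pi / 2 / (L / (2 * ε))) ^ 2 := by
  rw [gapConst]
  field_simp

theorem exists_quadraticSpectrum (hε : 0 < ε) (hL : 0 < L) :
    ∃ x, QuadraticSpectrum (gapConst ε L) x (shiftedEigenval ε L) := by
  have hl : 0 < L / (2 * ε) := by positivity
  have hm : 0 < L / (2 * ε) * Real.tanh (L / (2 * ε)) := mul_pos hl (tanh_pos hl)
  have := Real.pi_pos
  choose! θ hθ hphase hsq using fun (k : ℕ) (hk : 1 ≤ k) =>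
    (isLevel_shiftedEigenval hε hL k).exists_phase hk
  refine ⟨fun k => θ k / (Real.pi / 2), fun {k} hk => ?_, fun {k} hk => ?_,
    fun {j k} hj hjk => ?_, fun {k} hk => ?_, fun {k} hk => ?_⟩
  · rw [lt_div_iff₀ (by positivity), ← hphase k hk]
    exact phase_lt hm (hθ k hk)
  · rw [div_lt_iff₀ (by positivity)]
    linarith [sub_pi_div_two_lt_phase (L / (2 * ε) * Real.tanh (L / (2 * ε))) (θ k), hphase k hk]
  · rcases hjk.eq_or_lt with rfl | hlt
    · simp
    · rw [← sub_div, le_div_iff₀ (by positivity)]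
      exact phase_level_gap hm hlt (hθ j hj) (hθ k (hj.trans hjk)) (hphase j hj)
        (hphase k (hj.trans hjk))
  · refine mul_left_cancel₀ (by positivity : 4 * ε ≠ 0) ?_
    rw [hsq k hk, ← mul_assoc, four_mul_gapConst hε]
    field_simp
  · refine le_of_mul_le_mul_left ?_ (by positivity : 0 < 4 * ε)
    rw [four_mul_gapConst hε, mul_sub]
    exact IsLevel.sq_le_sub hl hk (isLevel_shiftedEigenval hε hL 0)
      (isLevel_shiftedEigenval hε hL k)

theorem abs_shiftedEigenval_zero_le (hε : 0 < ε) (hL : 0 < L) :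
    |shiftedEigenval ε L 0| ≤ 1 / (4 * ε) + gapConst ε L := by
  have hlevel := isLevel_shiftedEigenval hε hL 0
  have hlo := hlevel.neg_one_lt
  have hhi := hlevel.lt_sq (by positivity)
  rw [← four_mul_gapConst hε] at hhi
  have hhi' := lt_of_mul_lt_mul_left hhi (by positivity)
  have hlo' : -(1 / (4 * ε)) < shiftedEigenval ε L 0 := by
    rw [← neg_div, div_lt_iff₀ (by positivity)]
    linarith
  have := gapConst_pos hε hL
  have : 0 < 1 / (4 * ε) := by positivity
  exact abs_le.2 ⟨by linarith, by linarith⟩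

end Spectrum

section Laplace

variable {β : ℝ} {q r : ℝ → ℝ}

/-- The smooth real functions supported in `[-β, β]`. -/
structure IsTestFunction (β : ℝ) (q : ℝ → ℝ) : Prop where
  contDiff : ContDiff ℝ ∞ q
  tsupport_subset : tsupport q ⊆ Icc (-β) β

/-- The bilateral Laplace transform with the sign convention of the moments in `IsBiorthogonal`;
its values on the imaginary axis are the Fourier transform. -/
def laplace (q : ℝ → ℝ) (z : ℂ) : ℂ := ∫ t : ℝ, Complex.exp (z * t) * (q t : ℂ)

theorem laplace_const_mul (a : ℝ) (q : ℝ → ℝ) (z : ℂ) :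
    laplace (fun t => a * q t) z = a * laplace q z := by
  simp only [laplace, Complex.ofReal_mul, mul_left_comm, integral_const_mul]

theorem laplace_ofReal (q : ℝ → ℝ) (x : ℝ) :
    laplace q x = ((∫ t, Real.exp (x * t) * q t : ℝ) : ℂ) := by
  rw [laplace, ← integral_complex_ofReal]
  push_cast
  rfl

theorem fourier_ofReal_eq_laplace (q : ℝ → ℝ) (ξ : ℝ) :
    𝓕 (fun t => (q t : ℂ)) ξ = laplace q ((-(2 * Real.pi) * ξ : ℝ) * Complex.I) := by
  rw [Real.fourier_eq', laplace]
  congr with t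
  simp only [RCLike.inner_apply, conj_trivial, smul_eq_mul]
  push_cast
  ring_nf

namespace IsTestFunction

theorem hasCompactSupport (hq : IsTestFunction β q) : HasCompactSupport q :=
  isCompact_Icc.of_isClosed_subset (isClosed_tsupport q) hq.tsupport_subset

theorem eq_zero (hq : IsTestFunction β q) {t : ℝ} (ht : t ∉ Icc (-β) β) : q t = 0 :=
  image_eq_zero_of_notMem_tsupport fun h => ht (hq.tsupport_subset h)

theorem contDiff_ofReal (hq : IsTestFunction β q) : ContDiff ℝ ∞ fun t => (q t : ℂ) :=
  Complex.ofRealCLM.contDiff.comp hq.contDiff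

theorem hasCompactSupport_ofReal (hq : IsTestFunction β q) :
    HasCompactSupport fun t => (q t : ℂ) :=
  hq.hasCompactSupport.comp_left (g := Complex.ofReal) Complex.ofReal_zero

theorem integrable_mul (hq : IsTestFunction β q) {f : ℝ → ℂ} (hf : Continuous f) :
    Integrable fun t => f t * (q t : ℂ) :=
  (hf.mul hq.contDiff_ofReal.continuous).integrable_of_hasCompactSupport
    hq.hasCompactSupport_ofReal.mul_left

theorem integrable_exp_mul (hq : IsTestFunction β q) (z : ℂ) :
    Integrable fun t : ℝ => Complex.exp (z * t) * (q t : ℂ) :=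
  hq.integrable_mul (by fun_prop)

protected theorem const_mul (hq : IsTestFunction β q) (a : ℝ) : IsTestFunction β fun t => a * q t :=
  ⟨contDiff_const.mul hq.contDiff,
    (tsupport_mul_subset_right (f := fun _ => a)).trans hq.tsupport_subset⟩

protected theorem add (hq : IsTestFunction β q) (hr : IsTestFunction β r) :
    IsTestFunction β fun t => q t + r t :=
  ⟨hq.contDiff.add hr.contDiff,
    (tsupport_add q r).trans (union_subset hq.tsupport_subset hr.tsupport_subset)⟩

protected theorem deriv (hq : IsTestFunction β q) : IsTestFunction β (deriv q) :=
  ⟨(contDiff_infty_iff_deriv.1 hq.contDiff).2, tsupport_deriv_subset.trans hq.tsupport_subset⟩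

protected theorem iteratedDeriv (hq : IsTestFunction β q) (n : ℕ) :
    IsTestFunction β (iteratedDeriv n q) := by
  induction n with
  | zero => rwa [iteratedDeriv_zero]
  | succ n ih => rw [iteratedDeriv_succ]; exact ih.deriv

theorem laplace_add (hq : IsTestFunction β q) (hr : IsTestFunction β r) (z : ℂ) :
    laplace (fun t => q t + r t) z = laplace q z + laplace r z := by
  simp only [laplace, Complex.ofReal_add, mul_add]
  exact integral_add (hq.integrable_exp_mul z) (hr.integrable_exp_mul z)

theorem laplace_deriv (hq : IsTestFunction β q) (z : ℂ) :
    laplace (deriv q) z = -z * laplace q z := by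
  have hexp (t : ℝ) :
      HasDerivAt (fun t : ℝ => Complex.exp (z * t)) (z * Complex.exp (z * t)) t := by
    simpa [mul_comm] using ((hasDerivAt_id (t : ℂ)).const_mul z).cexp.comp_ofReal
  have hderiv (t : ℝ) : HasDerivAt (fun t => (q t : ℂ)) ((deriv q t : ℝ) : ℂ) t :=
    (hq.contDiff.differentiable (by simp) t).hasDerivAt.ofReal_comp
  have hparts := integral_mul_deriv_eq_deriv_mul_of_integrable (fun t _ => hexp t)
    (fun t _ => hderiv t) (hq.deriv.integrable_exp_mul z)
    (hq.integrable_mul (f := fun t => z * Complex.exp (z * t)) (by fun_prop))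
    (hq.integrable_exp_mul z)
  simp only [laplace, hparts, mul_assoc, integral_const_mul, neg_mul]

theorem laplace_iteratedDeriv (hq : IsTestFunction β q) (n : ℕ) (z : ℂ) :
    laplace (iteratedDeriv n q) z = (-z) ^ n * laplace q z := by
  induction n with
  | zero => simp
  | succ n ih => rw [iteratedDeriv_succ, (hq.iteratedDeriv n).laplace_deriv, ih, pow_succ']; ring

theorem exists_laplace_eq_aeval_mul (hq : IsTestFunction β q) (P : Polynomial ℝ) :
    ∃ r, IsTestFunction β r ∧ ∀ z, laplace r z = Polynomial.aeval z P * laplace q z := by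
  induction P using Polynomial.induction_on with
  | C a => exact ⟨_, hq.const_mul a, fun z => by simp [laplace_const_mul]⟩
  | add P Q hP hQ =>
    obtain ⟨r₁, h₁, e₁⟩ := hP
    obtain ⟨r₂, h₂, e₂⟩ := hQ
    exact ⟨_, h₁.add h₂, fun z => by rw [h₁.laplace_add h₂, e₁, e₂, map_add, add_mul]⟩
  | monomial n a hP =>
    obtain ⟨r, hr, e⟩ := hP
    refine ⟨_, hr.deriv.const_mul (-1), fun z => ?_⟩
    rw [laplace_const_mul, hr.laplace_deriv, e]
    simp only [map_mul, map_pow, Polynomial.aeval_X, Polynomial.aeval_C, pow_succ]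
    push_cast
    ring

theorem norm_laplace_mul_I_le (hq : IsTestFunction β q) (hβ : 0 ≤ β) {C : ℝ}
    (hC : ∀ t ∈ Ioo (-β) β, |q t| ≤ C) (τ : ℝ) :
    ‖laplace q (τ * Complex.I)‖ ≤ 2 * β * C := by
  have hnorm (t : ℝ) : ‖Complex.exp (τ * Complex.I * t) * (q t : ℂ)‖ = |q t| := by
    simp [Complex.norm_exp]
  have hzero (t : ℝ) (ht : t ∉ Icc (-β) β) : Complex.exp (τ * Complex.I * t) * (q t : ℂ) = 0 := by
    simp [hq.eq_zero ht]
  rw [laplace, ← setIntegral_eq_integral_of_forall_compl_eq_zero hzero,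
    integral_Icc_eq_integral_Ioo]
  calc _ ≤ C * volume.real (Ioo (-β) β) :=
        norm_setIntegral_le_of_norm_le_const (by simp) fun t ht => (hnorm t).trans_le (hC t ht)
    _ = 2 * β * C := by rw [Real.volume_real_Ioo_of_le (by linarith)]; ring

theorem integral_sq_eq (hq : IsTestFunction β q) :
    ∫ t, q t ^ 2 = (2 * Real.pi)⁻¹ * ∫ τ : ℝ, ‖laplace q (τ * Complex.I)‖ ^ 2 := by
  have hplancherel : ∫ ξ, ‖𝓕 (fun t => (q t : ℂ)) ξ‖ ^ 2 = ∫ t, ‖(q t : ℂ)‖ ^ 2 := by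
    have := SchwartzMap.integral_norm_sq_fourier
      (hq.hasCompactSupport_ofReal.toSchwartzMap hq.contDiff_ofReal)
    rwa [SchwartzMap.fourier_coe] at this
  simp only [Complex.norm_real, Real.norm_eq_abs, sq_abs, fourier_ofReal_eq_laplace] at hplancherel
  rw [← hplancherel, Measure.integral_comp_mul_left
    (fun τ : ℝ => ‖laplace q (τ * Complex.I)‖ ^ 2) (-(2 * Real.pi))]
  rw [smul_eq_mul, inv_neg, abs_neg, abs_of_pos (by positivity)]

theorem integral_sq_le (hq : IsTestFunction β q) {K : ℝ}
    (hK : ∀ τ : ℝ, ‖laplace q (τ * Complex.I)‖ ^ 2 ≤ K * (1 + τ ^ 2)⁻¹) :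
    ∫ t, q t ^ 2 ≤ K / 2 := by
  have hle : ∫ τ : ℝ, ‖laplace q (τ * Complex.I)‖ ^ 2 ≤ ∫ τ : ℝ, K * (1 + τ ^ 2)⁻¹ :=
    integral_mono_of_nonneg (.of_forall fun τ => by positivity)
      (integrable_inv_one_add_sq.const_mul K) (.of_forall hK)
  rw [integral_const_mul, integral_univ_inv_one_add_sq] at hle
  rw [hq.integral_sq_eq]
  calc _ ≤ (2 * Real.pi)⁻¹ * (K * Real.pi) := by gcongr
    _ = K / 2 := by field_simp

end IsTestFunction

end Laplace

section Gevrey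

variable {β ν : ℝ}

/-- The smooth bump `t ↦ exp (-ν / (1 - (t / β)²))` supported in `[-β, β]`, a Gevrey function of
order `2` that generates the biorthogonal family. -/
def bump (β ν t : ℝ) : ℝ := expNegInvGlue ((1 - (t / β) ^ 2) / ν)

/-- The holomorphic extension of `bump β ν` from `(-β, β)`. -/
def bumpExt (β ν : ℝ) (z : ℂ) : ℂ := Complex.exp (-(ν * (1 - (z / β) ^ 2)⁻¹))

theorem bump_nonneg (β ν t : ℝ) : 0 ≤ bump β ν t := expNegInvGlue.nonneg _

theorem bump_eq_zero (hβ : 0 < β) (hν : 0 < ν) {t : ℝ} (ht : β ≤ |t|) : bump β ν t = 0 := by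
  have hsq : 1 ≤ (t / β) ^ 2 := by
    rwa [one_le_sq_iff_one_le_abs, abs_div, abs_of_pos hβ, one_le_div hβ]
  exact expNegInvGlue.zero_of_nonpos
    (div_nonpos_of_nonpos_of_nonneg (sub_nonpos.2 hsq) hν.le)

theorem isTestFunction_bump (hβ : 0 < β) (hν : 0 < ν) : IsTestFunction β (bump β ν) where
  contDiff := expNegInvGlue.contDiff.comp (by fun_prop)
  tsupport_subset := closure_minimal
    (fun _ ht => abs_le.1 (le_of_not_ge fun h => ht (bump_eq_zero hβ hν h))) isClosed_Icc

theorem abs_div_lt_one_of_mem_Ioo (hβ : 0 < β) {t : ℝ} (ht : t ∈ Ioo (-β) β) : |t / β| < 1 := by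
  rw [abs_div, abs_of_pos hβ, div_lt_one hβ]
  exact abs_lt.2 ht

theorem bump_eq_re_bumpExt (hβ : 0 < β) (hν : 0 < ν) {t : ℝ} (ht : t ∈ Ioo (-β) β) :
    bump β ν t = (bumpExt β ν t).re := by
  have hsq : (t / β) ^ 2 < 1 := (sq_lt_one_iff_abs_lt_one _).2 (abs_div_lt_one_of_mem_Ioo hβ ht)
  have hpos : 0 < (1 - (t / β) ^ 2) / ν := div_pos (sub_pos.2 hsq) hν
  have hext : bumpExt β ν t = (Real.exp (-(ν * (1 - (t / β) ^ 2)⁻¹)) : ℂ) := by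
    rw [bumpExt]
    push_cast
    rfl
  rw [hext, Complex.ofReal_re, bump, expNegInvGlue, if_neg hpos.not_ge, inv_div, div_eq_mul_inv]

theorem half_inv_le_re_inv {u : ℝ} {w : ℂ} (hu : 0 < u) (hw : ‖w - u‖ < u) :
    w ≠ 0 ∧ 1 / (2 * u) ≤ (w⁻¹).re := by
  have hw₀ : w ≠ 0 := by
    rintro rfl
    simp [abs_of_pos hu] at hw
  have hnormSq : Complex.normSq (w - u) ≤ u ^ 2 := by
    rw [Complex.normSq_eq_norm_sq]
    gcongr
  refine ⟨hw₀, ?_⟩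
  rw [Complex.inv_re, div_le_div_iff₀ (by positivity) (Complex.normSq_pos.2 hw₀)]
  simp only [Complex.normSq_apply, Complex.sub_re, Complex.ofReal_re, Complex.sub_im,
    Complex.ofReal_im, sub_zero] at hnormSq ⊢
  linarith

theorem le_re_inv_one_sub_sq_of_nonneg {t : ℝ} {z : ℂ} (ht₀ : 0 ≤ t) (ht : t < 1)
    (hz : ‖z - t‖ < 1 - t) :
    1 - z ^ 2 ≠ 0 ∧ 1 / (4 * (1 - t)) + 1 / 4 ≤ ((1 - z ^ 2)⁻¹).re := by
  have hminus : ‖(1 - z) - (1 - t : ℝ)‖ < 1 - t := by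
    rwa [Complex.ofReal_sub, Complex.ofReal_one, sub_sub_sub_cancel_left, norm_sub_rev]
  have hplus : ‖(1 + z) - (1 : ℝ)‖ < 1 := by
    calc ‖(1 + z) - (1 : ℝ)‖ = ‖(z - t) + t‖ := by push_cast; ring_nf
      _ ≤ ‖z - t‖ + t := by
        simpa [abs_of_nonneg ht₀] using norm_add_le (z - t) (t : ℂ)
      _ < 1 := by linarith
  obtain ⟨hminus₀, hminus⟩ := half_inv_le_re_inv (sub_pos.2 ht) hminus
  obtain ⟨hplus₀, hplus⟩ := half_inv_le_re_inv one_pos hplus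
  have hfactor : 1 - z ^ 2 = (1 - z) * (1 + z) := by ring
  refine ⟨hfactor ▸ mul_ne_zero hminus₀ hplus₀, ?_⟩
  have hpartial : (1 - z ^ 2)⁻¹ = (1 / 2 : ℝ) * ((1 - z)⁻¹ + (1 + z)⁻¹) := by
    rw [hfactor]
    push_cast
    field_simp
    ring
  rw [hpartial, Complex.re_ofReal_mul, Complex.add_re]
  calc 1 / (4 * (1 - t)) + 1 / 4 = 1 / 2 * (1 / (2 * (1 - t)) + 1 / (2 * 1)) := by
        field_simp [(sub_pos.2 ht).ne']; ring
    _ ≤ _ := by gcongr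

theorem le_re_inv_one_sub_sq {t : ℝ} {z : ℂ} (ht : |t| < 1) (hz : ‖z - t‖ < 1 - |t|) :
    1 - z ^ 2 ≠ 0 ∧ 1 / (4 * (1 - |t|)) + 1 / 4 ≤ ((1 - z ^ 2)⁻¹).re := by
  rcases abs_cases t with ⟨h, hsign⟩ | ⟨h, hsign⟩
  · rw [h] at ht hz ⊢
    exact le_re_inv_one_sub_sq_of_nonneg hsign ht hz
  · rw [h] at ht hz ⊢
    have hneg : ‖-z - (-t : ℝ)‖ < 1 - -t := by
      rwa [Complex.ofReal_neg, neg_sub_neg, norm_sub_rev]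
    simpa using le_re_inv_one_sub_sq_of_nonneg (by linarith) ht hneg

theorem norm_bumpExt_le (hβ : 0 < β) (hν : 0 < ν) {t : ℝ} (ht : t ∈ Ioo (-β) β) {z : ℂ}
    (hz : z ∈ Metric.ball (t : ℂ) (β * (1 - |t / β|))) :
    DifferentiableAt ℂ (bumpExt β ν) z ∧
      ‖bumpExt β ν z‖ ≤ Real.exp (-(ν / (4 * (1 - |t / β|)))) * Real.exp (-(ν / 4)) := by
  have hscaled : ‖z / β - (t / β : ℝ)‖ < 1 - |t / β| := by
    rw [Complex.ofReal_div, ← sub_div, norm_div, Complex.norm_real, Real.norm_of_nonneg hβ.le,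
      div_lt_iff₀' hβ]
    exact mem_ball_iff_norm.1 hz
  obtain ⟨hne, hre⟩ := le_re_inv_one_sub_sq (abs_div_lt_one_of_mem_Ioo hβ ht) hscaled
  constructor
  · unfold bumpExt
    fun_prop (disch := exact hne)
  · rw [bumpExt, Complex.norm_exp, ← Real.exp_add, Real.exp_le_exp, Complex.neg_re,
      Complex.re_ofReal_mul]
    calc _ ≤ -(ν * (1 / (4 * (1 - |t / β|)) + 1 / 4)) := by gcongr
      _ = _ := by ring

theorem norm_iteratedDeriv_le_of_forall_mem_ball {f : ℂ → ℂ} {c : ℂ} {R C : ℝ} (hR : 0 < R)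
    (hf : DifferentiableOn ℂ f (Metric.ball c R)) (hC : ∀ z ∈ Metric.ball c R, ‖f z‖ ≤ C)
    (n : ℕ) : ‖iteratedDeriv n f c‖ ≤ n.factorial * C / R ^ n := by
  have hlt : ∀ r ∈ Ioo 0 R, ‖iteratedDeriv n f c‖ ≤ n.factorial * C / r ^ n := fun r hr =>
    Complex.norm_iteratedDeriv_le_of_forall_mem_sphere_norm_le n hr.1
      ((hf.mono (Metric.closedBall_subset_ball hr.2)).diffContOnCl_ball subset_rfl)
      fun z hz => hC z (Metric.closedBall_subset_ball hr.2 (Metric.sphere_subset_closedBall hz))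
  have hcont : ContinuousAt (fun r : ℝ => n.factorial * C / r ^ n) R := by
    fun_prop (disch := positivity)
  refine ge_of_tendsto (hcont.continuousWithinAt (s := Iio R)) ?_
  filter_upwards [Ioo_mem_nhdsLT hR] with r hr using hlt r hr

theorem iteratedDeriv_bump_eq_re (hβ : 0 < β) (hν : 0 < ν) (n : ℕ) :
    ∀ t ∈ Ioo (-β) β, iteratedDeriv n (bump β ν) t = (iteratedDeriv n (bumpExt β ν) t).re := by
  induction n with
  | zero => simpa only [iteratedDeriv_zero] using fun t ht => bump_eq_re_bumpExt hβ hν ht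
  | succ n ih =>
    intro t ht
    have hrad : 0 < β * (1 - |t / β|) :=
      mul_pos hβ (sub_pos.2 (abs_div_lt_one_of_mem_Ioo hβ ht))
    have hanalytic : AnalyticAt ℂ (bumpExt β ν) t :=
      DifferentiableOn.analyticAt
        (fun z hz => (norm_bumpExt_le hβ hν ht hz).1.differentiableWithinAt)
        (Metric.ball_mem_nhds _ hrad)
    have hdiff : DifferentiableAt ℂ (iteratedDeriv n (bumpExt β ν)) t := by
      rw [iteratedDeriv_eq_iterate]
      exact (hanalytic.iterated_deriv n).differentiableAt
    have heq : iteratedDeriv n (bump β ν) =ᶠ[nhds t]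
        fun s : ℝ => (iteratedDeriv n (bumpExt β ν) s).re := by
      filter_upwards [isOpen_Ioo.mem_nhds ht] with s hs using ih s hs
    rw [iteratedDeriv_succ, iteratedDeriv_succ, heq.deriv_eq]
    exact hdiff.hasDerivAt.real_of_complex.deriv

theorem abs_iteratedDeriv_bump_le (hβ : 0 < β) (hν : 0 < ν) {t : ℝ} (ht : t ∈ Ioo (-β) β)
    (n : ℕ) :
    |iteratedDeriv n (bump β ν) t| ≤
      (n.factorial : ℝ) ^ 2 * (4 / (β * ν)) ^ n * Real.exp (-(ν / 4)) := by
  have hu : 0 < 1 - |t / β| := sub_pos.2 (abs_div_lt_one_of_mem_Ioo hβ ht)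
  have hcauchy := norm_iteratedDeriv_le_of_forall_mem_ball (mul_pos hβ hu)
    (fun z hz => (norm_bumpExt_le hβ hν ht hz).1.differentiableWithinAt)
    (fun z hz => (norm_bumpExt_le hβ hν ht hz).2) n
  rw [iteratedDeriv_bump_eq_re hβ hν n t ht]
  refine (Complex.abs_re_le_norm _).trans (hcauchy.trans ?_)
  generalize 1 - |t / β| = u at hu ⊢
  have hexp : (ν / (4 * u)) ^ n * Real.exp (-(ν / (4 * u))) ≤ n.factorial := by
    rw [Real.exp_neg, ← div_eq_mul_inv, div_le_iff₀ (Real.exp_pos _),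
      ← div_le_iff₀' (by positivity)]
    exact Real.pow_div_factorial_le_exp _ (by positivity) n
  calc _ = n.factorial * ((ν / (4 * u)) ^ n * Real.exp (-(ν / (4 * u)))) *
        (4 / (β * ν)) ^ n * Real.exp (-(ν / 4)) := by
        have : (ν / (4 * u)) ^ n * (4 / (β * ν)) ^ n = ((β * u) ^ n)⁻¹ := by
          rw [← mul_pow, ← inv_pow]
          congr 1
          field_simp
        rw [div_eq_mul_inv, ← this]
        ring
    _ ≤ n.factorial * n.factorial * (4 / (β * ν)) ^ n * Real.exp (-(ν / 4)) := by gcongr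
    _ = _ := by ring

theorem pow_mul_norm_laplace_bump_le (hβ : 0 < β) (hν : 0 < ν) (τ : ℝ) (n : ℕ) :
    |τ| ^ n * ‖laplace (bump β ν) (τ * Complex.I)‖ ≤
      2 * β * ((n.factorial : ℝ) ^ 2 * (4 / (β * ν)) ^ n * Real.exp (-(ν / 4))) := by
  have hbump := isTestFunction_bump hβ hν
  have := (hbump.iteratedDeriv n).norm_laplace_mul_I_le hβ.le
    (fun t ht => abs_iteratedDeriv_bump_le hβ hν ht n) τ
  simpa [hbump.laplace_iteratedDeriv] using this

theorem factorial_sq_le (n : ℕ) :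
    (n.factorial : ℝ) ^ 2 ≤ Real.exp 2 * (n + 1) * ((n / Real.exp 1) ^ n) ^ 2 := by
  cases n with
  | zero => simp
  | succ n =>
    have hstirling : Stirling.stirlingSeq (n + 1) ≤ Real.exp 1 / √2 :=
      Stirling.stirlingSeq_one ▸ Stirling.stirlingSeq'_antitone (Nat.zero_le n)
    rw [Stirling.stirlingSeq, div_le_iff₀ (by positivity)] at hstirling
    calc ((n + 1).factorial : ℝ) ^ 2
        ≤ (Real.exp 1 / √2 * (√(2 * (n + 1 : ℕ)) * ((n + 1 : ℕ) / Real.exp 1) ^ (n + 1))) ^ 2 := by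
          gcongr
      _ = Real.exp 2 * (n + 1 : ℕ) * (((n + 1 : ℕ) / Real.exp 1) ^ (n + 1)) ^ 2 := by
          rw [mul_pow, mul_pow, div_pow, Real.sq_sqrt (by positivity), Real.sq_sqrt (by positivity),
            ← Real.exp_nat_mul]
          norm_num
          ring
      _ ≤ _ := by
          gcongr
          linarith

/-- Optimal truncation: the choice `n ≈ r / 2` turns Gevrey bounds of order `2` into decay. -/
theorem le_mul_exp_neg_of_forall_pow_mul_le {A C r : ℝ} (hC : 0 ≤ C) (hr : 0 ≤ r)
    (h : ∀ n : ℕ, (r ^ 2) ^ n * A ≤ C * ((n.factorial : ℝ) ^ 2 * 4 ^ n)) :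
    A ≤ C * (Real.exp 4 * (1 + r) * Real.exp (-r)) := by
  set n := ⌊r / 2⌋₊ with hn
  have hle : (n : ℝ) ≤ r / 2 := Nat.floor_le (by positivity)
  have hlt : r / 2 < n + 1 := Nat.lt_floor_add_one _
  have hpow : 0 < (r ^ 2) ^ n := by
    rcases hr.eq_or_lt with rfl | hr
    · simp [hn]
    · positivity
  have hexp : (Real.exp 1)⁻¹ ^ n * (Real.exp 1)⁻¹ ^ n ≤ Real.exp (2 - r) := by
    rw [← Real.exp_neg, ← Real.exp_nat_mul, ← Real.exp_add]
    gcongr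
    linarith
  refine le_of_mul_le_mul_left ((h n).trans ?_) hpow
  calc C * ((n.factorial : ℝ) ^ 2 * 4 ^ n)
      ≤ C * ((Real.exp 2 * (n + 1) * ((n / Real.exp 1) ^ n) ^ 2) * 4 ^ n) := by
        gcongr; exact factorial_sq_le n
    _ = C * (Real.exp 2 * (1 + n) * ((2 * n) ^ 2) ^ n *
        ((Real.exp 1)⁻¹ ^ n * (Real.exp 1)⁻¹ ^ n)) := by
        rw [show (2 * (n : ℝ)) ^ 2 = 4 * n ^ 2 by ring]
        simp only [div_eq_mul_inv, mul_pow]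
        ring
    _ ≤ C * (Real.exp 2 * (1 + r) * (r ^ 2) ^ n * Real.exp (2 - r)) := by
        gcongr <;> linarith
    _ = (r ^ 2) ^ n * (C * (Real.exp 4 * (1 + r) * Real.exp (-r))) := by
        rw [show (4 : ℝ) = 2 + 2 by norm_num, sub_eq_add_neg, Real.exp_add, Real.exp_add]
        ring

theorem norm_laplace_bump_le (hβ : 0 < β) (hν : 0 < ν) (τ : ℝ) :
    ‖laplace (bump β ν) (τ * Complex.I)‖ ≤ 2 * β * Real.exp (-(ν / 4)) *
      (Real.exp 4 * (1 + √(β * ν * |τ|)) * Real.exp (-√(β * ν * |τ|))) := by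
  refine le_mul_exp_neg_of_forall_pow_mul_le (by positivity) (by positivity) fun n => ?_
  rw [Real.sq_sqrt (by positivity), mul_pow, mul_assoc]
  calc _ ≤ (β * ν) ^ n *
        (2 * β * ((n.factorial : ℝ) ^ 2 * (4 / (β * ν)) ^ n * Real.exp (-(ν / 4)))) :=
        mul_le_mul_of_nonneg_left (pow_mul_norm_laplace_bump_le hβ hν τ n) (by positivity)
    _ = _ := by
      rw [div_pow]
      field_simp

theorem exp_neg_le_bump (hβ : 0 < β) (hν : 0 < ν) {t : ℝ} (ht₀ : 0 ≤ t)
    (ht : t ≤ β / (ν + 2)) : Real.exp (-(ν + 1)) ≤ bump β ν t := by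
  have hscaled : t / β ≤ 1 / (ν + 2) := by
    rw [div_le_iff₀ hβ]
    exact ht.trans_eq (by ring)
  have hsq : (t / β) ^ 2 ≤ 1 / (ν + 1) :=
    calc (t / β) ^ 2 ≤ (1 / (ν + 2)) ^ 2 := by gcongr
      _ ≤ 1 / (ν + 1) := by
        rw [div_pow, one_pow, div_le_div_iff₀ (by positivity) (by positivity)]
        nlinarith
  have hglue : Real.exp (-(ν + 1)) = expNegInvGlue (1 / (ν + 1)) := by
    rw [expNegInvGlue, if_neg (by positivity : 0 < 1 / (ν + 1)).not_ge, one_div, inv_inv]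
  rw [hglue, bump]
  refine expNegInvGlue.monotone ?_
  rw [le_div_iff₀ hν]
  calc 1 / (ν + 1) * ν = 1 - 1 / (ν + 1) := by field_simp; ring
    _ ≤ 1 - (t / β) ^ 2 := by gcongr

theorem le_integral_exp_mul_bump (hβ : 0 < β) (hν : 0 < ν) {x : ℝ} (hx : 0 ≤ x) :
    β / (2 * (ν + 2)) * (Real.exp (x * (β / (2 * (ν + 2)))) * Real.exp (-(ν + 1))) ≤
      ∫ t, Real.exp (x * t) * bump β ν t := by
  set d := β / (2 * (ν + 2)) with hd
  have hd₀ : 0 < d := by positivity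
  have htwo : 2 * d = β / (ν + 2) := by rw [hd]; field_simp
  have hint : Integrable fun t => Real.exp (x * t) * bump β ν t := by
    have hbump := isTestFunction_bump hβ hν
    exact (((Real.continuous_exp.comp (by fun_prop)).mul hbump.contDiff.continuous)
      |>.integrable_of_hasCompactSupport hbump.hasCompactSupport.mul_left)
  calc d * (Real.exp (x * d) * Real.exp (-(ν + 1)))
      = ∫ _ in Icc d (2 * d), Real.exp (x * d) * Real.exp (-(ν + 1)) := by
        rw [setIntegral_const, Real.volume_real_Icc_of_le (by linarith), smul_eq_mul]
        ring
    _ ≤ ∫ t in Icc d (2 * d), Real.exp (x * t) * bump β ν t := by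
        refine setIntegral_mono_on continuous_const.integrableOn_Icc hint.integrableOn
          measurableSet_Icc fun t ht => ?_
        have hbump := exp_neg_le_bump hβ hν (hd₀.le.trans ht.1) (ht.2.trans_eq htwo)
        gcongr
        exact ht.1
    _ ≤ ∫ t, Real.exp (x * t) * bump β ν t :=
        setIntegral_le_integral hint
          (.of_forall fun t => mul_nonneg (Real.exp_pos _).le (bump_nonneg β ν t))

end Gevrey

section Products

theorem norm_sin_le_exp (w : ℂ) : ‖Complex.sin w‖ ≤ Real.exp |w.im| := by
  have hneg : ‖Complex.exp (-w * Complex.I)‖ ≤ Real.exp |w.im| := by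
    rw [Complex.norm_exp, Real.exp_le_exp]
    simpa using le_abs_self w.im
  have hpos : ‖Complex.exp (w * Complex.I)‖ ≤ Real.exp |w.im| := by
    rw [Complex.norm_exp, Real.exp_le_exp]
    simpa using neg_le_abs w.im
  rw [Complex.sin, norm_div, norm_mul, Complex.norm_I, mul_one, Complex.norm_two,
    div_le_iff₀ two_pos]
  linarith [norm_sub_le (Complex.exp (-w * Complex.I)) (Complex.exp (w * Complex.I))]

theorem sq_norm_ofReal_add_ofReal_mul_I (a b : ℝ) :
    ‖(a : ℂ) + b * Complex.I‖ ^ 2 = a ^ 2 + b ^ 2 := by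
  rw [← Complex.normSq_eq_norm_sq, Complex.normSq_add_mul_I]

theorem sq_norm_sin_partial_prod {y : ℝ} (hy : 0 ≤ y) {z : ℂ} (hz : z ^ 2 = y * Complex.I)
    (N : ℕ) :
    ‖Real.pi * z * ∏ j ∈ Finset.range N, (1 - z ^ 2 / ((j : ℂ) + 1) ^ 2)‖ ^ 2 =
      Real.pi ^ 2 * y * ∏ j ∈ Finset.range N, (1 + (y / ((j : ℝ) + 1) ^ 2) ^ 2) := by
  have hfactor (j : ℕ) :
      ‖1 - z ^ 2 / ((j : ℂ) + 1) ^ 2‖ ^ 2 = 1 + (y / ((j : ℝ) + 1) ^ 2) ^ 2 := by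
    have := sq_norm_ofReal_add_ofReal_mul_I 1 (-(y / ((j : ℝ) + 1) ^ 2))
    rw [one_pow, neg_sq] at this
    rw [← this, hz]
    congr 2
    push_cast
    ring
  rw [norm_mul, mul_pow, norm_mul, mul_pow, norm_prod, ← Finset.prod_pow,
    Finset.prod_congr rfl fun j _ => hfactor j, ← norm_pow z, hz]
  simp [abs_of_nonneg hy]

-- Euler's product for `sin (π z)` at `z² = i y`, whose partial products increase in modulus.
theorem pi_sq_mul_prod_le_exp {y : ℝ} (hy : 0 ≤ y) (N : ℕ) :
    Real.pi ^ 2 * y * ∏ j ∈ Finset.range N, (1 + (y / ((j : ℝ) + 1) ^ 2) ^ 2) ≤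
      Real.exp (Real.pi * √(2 * y)) := by
  set r := √(2 * y) / 2 with hr
  set z : ℂ := r * (1 + Complex.I) with hz
  have hz_sq : z ^ 2 = y * Complex.I := by
    have hr_sq : (r : ℂ) ^ 2 = (y / 2 : ℝ) := by
      rw [← Complex.ofReal_pow, hr, div_pow, Real.sq_sqrt (by positivity)]
      ring_nf
    rw [hz, mul_pow, hr_sq]
    push_cast
    linear_combination (y / 2 : ℂ) * Complex.I_sq
  have hlim := ((Complex.tendsto_euler_sin_prod z).norm).pow 2
  simp only [sq_norm_sin_partial_prod hy hz_sq] at hlim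
  have hmono : Monotone fun n : ℕ =>
      Real.pi ^ 2 * y * ∏ j ∈ Finset.range n, (1 + (y / ((j : ℝ) + 1) ^ 2) ^ 2) := by
    refine monotone_nat_of_le_succ fun n => ?_
    rw [Finset.prod_range_succ]
    gcongr
    refine le_mul_of_one_le_right (Finset.prod_nonneg fun j _ => by positivity) ?_
    exact le_add_of_nonneg_right (sq_nonneg _)
  have hsin : ‖Complex.sin (Real.pi * z)‖ ≤ Real.exp (Real.pi * r) := by
    have him : (Real.pi * z).im = Real.pi * r := by simp [hz]
    rw [← abs_of_nonneg (show 0 ≤ Real.pi * r by positivity), ← him]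
    exact norm_sin_le_exp _
  calc _ ≤ ‖Complex.sin (Real.pi * z)‖ ^ 2 := hmono.ge_of_tendsto hlim N
    _ ≤ Real.exp (Real.pi * r) ^ 2 := by gcongr
    _ = Real.exp (Real.pi * √(2 * y)) := by
      rw [← Real.exp_nat_mul, hr]
      congr 1
      push_cast
      ring

theorem prod_one_add_sq_le_exp {y : ℝ} (hy : 0 ≤ y) (N : ℕ) :
    ∏ j ∈ Finset.Icc 1 N, (1 + (y / (j : ℝ) ^ 2) ^ 2) ≤
      Real.exp 5 * Real.exp (Real.pi * √(2 * y)) := by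
  have hlarge {y : ℝ} (hy : 1 ≤ y) :
      ∏ j ∈ Finset.range N, (1 + (y / ((j : ℝ) + 1) ^ 2) ^ 2) ≤ Real.exp (Real.pi * √(2 * y)) := by
    refine le_trans ?_ (pi_sq_mul_prod_le_exp (by linarith) N)
    refine le_mul_of_one_le_left (Finset.prod_nonneg fun j _ => by positivity) ?_
    nlinarith [Real.pi_gt_three]
  have hone : Real.pi * √(2 * 1) ≤ 5 := by
    have : √(2 * 1 : ℝ) ≤ 1.42 := Real.sqrt_le_iff.2 (by norm_num)
    exact (mul_le_mul Real.pi_lt_d2.le this (Real.sqrt_nonneg _) (by norm_num)).trans (by norm_num)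
  have hshift : ∏ j ∈ Finset.Icc 1 N, (1 + (y / (j : ℝ) ^ 2) ^ 2) =
      ∏ j ∈ Finset.range N, (1 + (y / ((j : ℝ) + 1) ^ 2) ^ 2) := by
    rw [← Finset.Ico_add_one_right_eq_Icc, Finset.prod_Ico_eq_prod_range]
    simp [add_comm]
  rw [hshift]
  rcases le_total 1 y with h | h
  · exact (hlarge h).trans
      (le_mul_of_one_le_left (Real.exp_pos _).le (Real.one_le_exp (by norm_num)))
  · calc ∏ j ∈ Finset.range N, (1 + (y / ((j : ℝ) + 1) ^ 2) ^ 2)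
        ≤ ∏ j ∈ Finset.range N, (1 + (1 / ((j : ℝ) + 1) ^ 2) ^ 2) := by gcongr
      _ ≤ Real.exp (Real.pi * √(2 * 1)) := hlarge le_rfl
      _ ≤ Real.exp 5 := Real.exp_le_exp.2 hone
      _ ≤ _ := le_mul_of_one_le_right (Real.exp_pos _).le (Real.one_le_exp (by positivity))

theorem prod_sq_div_sub_one_mul_factorial (n m : ℕ) :
    (∏ i ∈ Finset.range n, (((n + m + 1 : ℝ) / (i + 1)) ^ 2 - 1)) *
      (m.factorial * (n + m + 1).factorial * (n.factorial : ℝ) ^ 2) =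
      (n + m).factorial * (2 * n + m + 1).factorial := by
  induction n generalizing m with
  | zero => simp [mul_comm]
  | succ n ih =>
    have h := ih (m + 1)
    have hfactor : ((n + m + 2 : ℝ) / (n + 1)) ^ 2 - 1 =
        (m + 1) * (2 * n + m + 3) / (n + 1) ^ 2 := by
      field_simp
      ring
    rw [show n + (m + 1) = n + m + 1 by ring, show 2 * n + (m + 1) + 1 = 2 * n + m + 2 by ring,
      show (n + (m + 1 : ℕ) + 1 : ℝ) = n + m + 2 by push_cast; ring, Nat.factorial_succ m] at h
    rw [Finset.prod_range_succ, show n + 1 + m = n + m + 1 by ring,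
      show 2 * (n + 1) + m + 1 = 2 * n + m + 2 + 1 by ring,
      show ((n + 1 : ℕ) + m + 1 : ℝ) = n + m + 2 by push_cast; ring, hfactor,
      Nat.factorial_succ n, Nat.factorial_succ (2 * n + m + 2)]
    push_cast at h ⊢
    generalize ∏ i ∈ Finset.range n, (((n + m + 2 : ℝ) / (i + 1)) ^ 2 - 1) = A at *
    field_simp
    linear_combination (2 * n + m + 3 : ℝ) * h

theorem prod_one_sub_sq_div_mul_factorial (K r : ℕ) :
    (∏ i ∈ Finset.range r, (1 - ((K : ℝ) / (K + i + 1)) ^ 2)) *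
      ((2 * K).factorial * ((K + r).factorial : ℝ) ^ 2) =
      r.factorial * (2 * K + r).factorial * (K.factorial : ℝ) ^ 2 := by
  induction r with
  | zero => simp
  | succ r ih =>
    have hfactor : 1 - ((K : ℝ) / (K + r + 1)) ^ 2 =
        (r + 1) * (2 * K + r + 1) / (K + r + 1) ^ 2 := by
      field_simp
      ring
    rw [Finset.prod_range_succ, ← add_assoc, ← add_assoc, Nat.factorial_succ, Nat.factorial_succ,
      Nat.factorial_succ, hfactor]
    push_cast
    generalize ∏ i ∈ Finset.range r, (1 - ((K : ℝ) / (K + i + 1)) ^ 2) = A at *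
    field_simp
    linear_combination ih

theorem factorial_add_sq_le (K r : ℕ) :
    (K + r).factorial ^ 2 ≤ r.factorial * (2 * K + r).factorial := by
  have hcentral := Nat.choose_mul_factorial_mul_factorial (show K + r ≤ 2 * (K + r) by lia)
  have hchoose := Nat.choose_mul_factorial_mul_factorial (show r ≤ 2 * (K + r) by lia)
  rw [show 2 * (K + r) - (K + r) = K + r by lia, ← Nat.centralBinom, mul_assoc, ← sq] at hcentral
  rw [show 2 * (K + r) - r = 2 * K + r by lia, mul_assoc] at hchoose
  refine Nat.le_of_mul_le_mul_left ?_ (Nat.centralBinom_pos (K + r))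
  rw [hcentral, ← hchoose]
  exact Nat.mul_le_mul_right _ (Nat.choose_le_centralBinom r (K + r))

theorem prod_sq_div_sub_one_eq (k : ℕ) :
    ∏ i ∈ Finset.range k, (((k + 1 : ℝ) / (i + 1)) ^ 2 - 1) = ((k + 1).centralBinom : ℝ) / 2 := by
  have h := prod_sq_div_sub_one_mul_factorial k 0
  have hcentral := Nat.choose_mul_factorial_mul_factorial (show k + 1 ≤ 2 * (k + 1) by lia)
  rw [show 2 * (k + 1) - (k + 1) = k + 1 by lia, ← Nat.centralBinom,
    show 2 * (k + 1) = 2 * k + 1 + 1 by ring, Nat.factorial_succ (2 * k + 1),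
    Nat.factorial_succ k] at hcentral
  have hcentral' : ((k + 1).centralBinom : ℝ) * ((k + 1) * k.factorial) * ((k + 1) * k.factorial) =
      (2 * k + 1 + 1) * (2 * k + 1).factorial := by exact_mod_cast hcentral
  simp only [CharP.cast_eq_zero, add_zero, Nat.factorial_zero, Nat.factorial_succ k] at h
  push_cast at h
  have hne : (k.factorial : ℝ) ^ 3 * (k + 1) ^ 2 ≠ 0 := by positivity
  refine mul_right_cancel₀ hne ?_
  linear_combination (k + 1 : ℝ) * h - (k.factorial / 2 : ℝ) * hcentral'

theorem one_le_prod_one_sub_sq_div_mul_centralBinom (K r : ℕ) :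
    (1 : ℝ) ≤ (∏ i ∈ Finset.range r, (1 - ((K : ℝ) / (K + i + 1)) ^ 2)) * K.centralBinom := by
  have h := prod_one_sub_sq_div_mul_factorial K r
  have hcentral := Nat.choose_mul_factorial_mul_factorial (show K ≤ 2 * K by lia)
  rw [show 2 * K - K = K by lia, ← Nat.centralBinom] at hcentral
  have hle : ((K + r).factorial : ℝ) ^ 2 ≤ r.factorial * (2 * K + r).factorial := by
    exact_mod_cast factorial_add_sq_le K r
  refine le_of_mul_le_mul_right ?_
    (show (0 : ℝ) < (K.factorial : ℝ) ^ 2 * ((K + r).factorial : ℝ) ^ 2 by positivity)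
  rw [← hcentral] at h
  push_cast at h
  nlinarith [mul_le_mul_of_nonneg_left hle (sq_nonneg (K.factorial : ℝ))]

theorem half_le_prod_abs_sq_div_sub_one {k n : ℕ} (hkn : k < n) :
    1 / 2 ≤ ∏ j ∈ (Finset.range n).erase k, |((k + 1 : ℝ) / (j + 1)) ^ 2 - 1| := by
  have hsplit : (Finset.range n).erase k = Finset.range k ∪ Finset.Ico (k + 1) n := by
    ext j
    simp only [Finset.mem_erase, Finset.mem_range, Finset.mem_union, Finset.mem_Ico]
    lia
  have hdisj : Disjoint (Finset.range k) (Finset.Ico (k + 1) n) := by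
    rw [Finset.disjoint_left]
    intro j
    simp only [Finset.mem_range, Finset.mem_Ico]
    lia
  have hbelow : ((k + 1).centralBinom : ℝ) / 2 ≤
      ∏ j ∈ Finset.range k, |((k + 1 : ℝ) / (j + 1)) ^ 2 - 1| := by
    rw [← prod_sq_div_sub_one_eq, ← Finset.abs_prod]
    exact le_abs_self _
  have habove : ∏ i ∈ Finset.range (n - (k + 1)),
      (1 - (((k + 1 : ℕ) : ℝ) / ((k + 1 : ℕ) + i + 1)) ^ 2) ≤
      ∏ j ∈ Finset.Ico (k + 1) n, |((k + 1 : ℝ) / (j + 1)) ^ 2 - 1| := by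
    refine (le_abs_self _).trans_eq ?_
    rw [Finset.abs_prod, Finset.prod_Ico_eq_prod_range]
    refine Finset.prod_congr rfl fun i _ => ?_
    rw [abs_sub_comm]
    push_cast
    rfl
  have hone := one_le_prod_one_sub_sq_div_mul_centralBinom (k + 1) (n - (k + 1))
  rw [hsplit, Finset.prod_union hdisj]
  calc (1 : ℝ) / 2 ≤ ((k + 1).centralBinom : ℝ) / 2 * ∏ i ∈ Finset.range (n - (k + 1)),
        (1 - (((k + 1 : ℕ) : ℝ) / ((k + 1 : ℕ) + i + 1)) ^ 2) := by linarith
    _ ≤ ((k + 1).centralBinom : ℝ) / 2 *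
        ∏ j ∈ Finset.Ico (k + 1) n, |((k + 1 : ℝ) / (j + 1)) ^ 2 - 1| := by gcongr
    _ ≤ _ := by gcongr

end Products

section Interpolation

variable {c B : ℝ} {x μ : ℕ → ℝ} {j k N : ℕ}

theorem sq_norm_aeval_basisDivisor (a b τ : ℝ) :
    ‖Polynomial.aeval (τ * Complex.I) (Lagrange.basisDivisor a b)‖ ^ 2 =
      (τ ^ 2 + b ^ 2) / (a - b) ^ 2 := by
  have heval : Polynomial.aeval (τ * Complex.I) (Lagrange.basisDivisor a b) =
      ((a - b)⁻¹ : ℝ) * ((-b : ℝ) + τ * Complex.I) := by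
    rw [Lagrange.basisDivisor, map_mul, map_sub, Polynomial.aeval_C, Polynomial.aeval_C,
      Polynomial.aeval_X, Complex.coe_algebraMap]
    push_cast
    ring
  rw [heval, norm_mul, mul_pow, sq_norm_ofReal_add_ofReal_mul_I, Complex.norm_real,
    Real.norm_eq_abs, sq_abs, inv_pow]
  ring

theorem range_succ_erase_eq_insert (hk : k ≠ 0) :
    (Finset.range (N + 1)).erase k = insert 0 ((Finset.Icc 1 N).erase k) := by
  ext j
  simp only [Finset.mem_erase, Finset.mem_range, Finset.mem_insert, Finset.mem_Icc]
  lia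

namespace QuadraticSpectrum

theorem root_pos (h : QuadraticSpectrum c x μ) (hk : 1 ≤ k) : 0 < x k :=
  (Nat.cast_nonneg k).trans_lt (h.lt_root hk)

theorem eigenvalue_pos (h : QuadraticSpectrum c x μ) (hc : 0 < c) (hk : 1 ≤ k) : 0 < μ k := by
  have := h.root_pos hk
  rw [h.eq_mul_sq hk]
  positivity

theorem root_lt_root (h : QuadraticSpectrum c x μ) (hj : 1 ≤ j) (hjk : j < k) : x j < x k := by
  have hgap := h.sub_le_sub_root hj hjk.le
  have : (j : ℝ) < k := by exact_mod_cast hjk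
  linarith

theorem strictMono (h : QuadraticSpectrum c x μ) (hc : 0 < c) : StrictMono μ := by
  intro j k hjk
  rcases Nat.eq_zero_or_pos j with rfl | hj
  · linarith [h.le_sub_zero hjk]
  · rw [h.eq_mul_sq hj, h.eq_mul_sq (hj.trans_le hjk.le)]
    have := h.root_lt_root hj hjk
    have := h.root_pos hj
    gcongr

theorem succ_div_succ_le_root_div_root (h : QuadraticSpectrum c x μ) (hj : 1 ≤ j) (hjk : j ≤ k) :
    (k + 1 : ℝ) / (j + 1) ≤ x k / x j := by
  rw [div_le_div_iff₀ (by positivity) (h.root_pos hj)]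
  have hgap := h.sub_le_sub_root hj hjk
  have hlt := h.root_lt hj
  have hjk' : (j : ℝ) ≤ k := by exact_mod_cast hjk
  nlinarith

theorem abs_succ_div_succ_sq_sub_one_le (h : QuadraticSpectrum c x μ) (hj : 1 ≤ j) (hk : 1 ≤ k) :
    |((k + 1 : ℝ) / (j + 1)) ^ 2 - 1| ≤ |1 - x k ^ 2 / x j ^ 2| := by
  have hxj := h.root_pos hj
  have hxk := h.root_pos hk
  rw [← div_pow, abs_sub_comm 1]
  rcases le_total j k with hjk | hkj
  · have hle := h.succ_div_succ_le_root_div_root hj hjk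
    have hjk' : (j : ℝ) ≤ k := by exact_mod_cast hjk
    have hone : 1 ≤ (k + 1 : ℝ) / (j + 1) := (one_le_div (by positivity)).2 (by linarith)
    rw [abs_of_nonneg (sub_nonneg.2 (one_le_pow₀ hone)),
      abs_of_nonneg (sub_nonneg.2 (one_le_pow₀ (hone.trans hle)))]
    gcongr
  · have hle : x k / x j ≤ (k + 1 : ℝ) / (j + 1) := by
      have := inv_anti₀ (by positivity) (h.succ_div_succ_le_root_div_root hk hkj)
      rwa [inv_div, inv_div] at this
    have hkj' : (k : ℝ) ≤ j := by exact_mod_cast hkj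
    have hone : (k + 1 : ℝ) / (j + 1) ≤ 1 := (div_le_one (by positivity)).2 (by linarith)
    rw [abs_of_nonpos (sub_nonpos.2 (pow_le_one₀ (by positivity) hone)),
      abs_of_nonpos (sub_nonpos.2 (pow_le_one₀ (by positivity) (hle.trans hone)))]
    gcongr

theorem inv_le_prod_abs_one_sub (h : QuadraticSpectrum c x μ) (hk : 1 ≤ k) (hkN : k ≤ N) :
    (2 * (k * (k + 2)) : ℝ)⁻¹ ≤ ∏ j ∈ (Finset.Icc 1 N).erase k, |1 - x k ^ 2 / x j ^ 2| := by
  have hle : ∏ j ∈ (Finset.Icc 1 N).erase k, |((k + 1 : ℝ) / (j + 1)) ^ 2 - 1| ≤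
      ∏ j ∈ (Finset.Icc 1 N).erase k, |1 - x k ^ 2 / x j ^ 2| :=
    Finset.prod_le_prod (fun _ _ => abs_nonneg _) fun j hj =>
      h.abs_succ_div_succ_sq_sub_one_le (Finset.mem_Icc.1 (Finset.mem_of_mem_erase hj)).1 hk
  have hhalf := half_le_prod_abs_sq_div_sub_one (Nat.lt_succ_of_le hkN)
  have hzero : |((k + 1 : ℝ) / ((0 : ℕ) + 1)) ^ 2 - 1| = (k * (k + 2) : ℝ) := by
    rw [show ((k + 1 : ℝ) / ((0 : ℕ) + 1)) ^ 2 - 1 = (k * (k + 2) : ℝ) by push_cast; ring]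
    exact abs_of_nonneg (by positivity)
  rw [Nat.succ_eq_add_one, range_succ_erase_eq_insert (by lia), Finset.prod_insert (by simp),
    hzero] at hhalf
  refine le_trans ?_ hle
  have : (0 : ℝ) < k := by exact_mod_cast hk
  rw [inv_le_iff_one_le_mul₀ (by positivity)]
  linarith

theorem prod_one_add_div_sq_le_exp (h : QuadraticSpectrum c x μ) (hc : 0 < c) (k N : ℕ) (τ : ℝ) :
    ∏ j ∈ (Finset.Icc 1 N).erase k, (1 + (τ / μ j) ^ 2) ≤
      Real.exp 5 * Real.exp (Real.pi * √(2 * (|τ| / c))) := by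
  calc ∏ j ∈ (Finset.Icc 1 N).erase k, (1 + (τ / μ j) ^ 2)
      ≤ ∏ j ∈ (Finset.Icc 1 N).erase k, (1 + (|τ| / c / (j : ℝ) ^ 2) ^ 2) := by
        refine Finset.prod_le_prod (fun j _ => by positivity) fun j hj => ?_
        have hj' : 1 ≤ j := (Finset.mem_Icc.1 (Finset.mem_of_mem_erase hj)).1
        have : (0 : ℝ) < j := by exact_mod_cast hj'
        have hlt := h.lt_root hj'
        rw [← sq_abs, abs_div, abs_of_pos (h.eigenvalue_pos hc hj'), h.eq_mul_sq hj', ← div_div]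
        gcongr
    _ ≤ ∏ j ∈ Finset.Icc 1 N, (1 + (|τ| / c / (j : ℝ) ^ 2) ^ 2) :=
        Finset.prod_le_prod_of_subset_of_one_le (Finset.erase_subset _ _)
          (fun j _ => by positivity) fun j _ _ => le_add_of_nonneg_right (sq_nonneg _)
    _ ≤ _ := prod_one_add_sq_le_exp (by positivity) N

theorem sq_norm_aeval_basisDivisor_eq (h : QuadraticSpectrum c x μ) (hc : 0 < c) (hj : 1 ≤ j)
    (hk : 1 ≤ k) (τ : ℝ) :
    ‖Polynomial.aeval (τ * Complex.I) (Lagrange.basisDivisor (μ k) (μ j))‖ ^ 2 =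
      (1 + (τ / μ j) ^ 2) * (|1 - x k ^ 2 / x j ^ 2| ^ 2)⁻¹ := by
  have hμ := h.eigenvalue_pos hc hj
  have hratio : 1 - x k ^ 2 / x j ^ 2 = -(μ k - μ j) / μ j := by
    have := h.root_pos hj
    rw [h.eq_mul_sq hj, h.eq_mul_sq hk]
    field_simp
    ring
  rw [sq_norm_aeval_basisDivisor, hratio, sq_abs, neg_div, neg_sq]
  field_simp
  ring

theorem sq_norm_aeval_basis_le (h : QuadraticSpectrum c x μ) (hc : 0 < c) (hB : |μ 0| ≤ B)
    (hk : 1 ≤ k) (hkN : k ≤ N) (τ : ℝ) :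
    ‖Polynomial.aeval (τ * Complex.I) (Lagrange.basis (Finset.range (N + 1)) μ k)‖ ^ 2 ≤
      (τ ^ 2 + B ^ 2) / c ^ 2 * (2 * (k * (k + 2))) ^ 2 *
        (Real.exp 5 * Real.exp (Real.pi * √(2 * (|τ| / c)))) := by
  set Q := ∏ j ∈ (Finset.Icc 1 N).erase k, |1 - x k ^ 2 / x j ^ 2|
  have hfactor (j) (hj : j ∈ (Finset.Icc 1 N).erase k) :=
    h.sq_norm_aeval_basisDivisor_eq hc (Finset.mem_Icc.1 (Finset.mem_of_mem_erase hj)).1 hk τ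
  have hzero : (τ ^ 2 + μ 0 ^ 2) / (μ k - μ 0) ^ 2 ≤ (τ ^ 2 + B ^ 2) / c ^ 2 := by
    have hsq : μ 0 ^ 2 ≤ B ^ 2 := sq_le_sq.2 (hB.trans (le_abs_self B))
    have hgap := h.le_sub_zero hk
    gcongr
  have hQ : (Q ^ 2)⁻¹ ≤ (2 * (k * (k + 2))) ^ 2 := by
    have : (0 : ℝ) < k := by exact_mod_cast hk
    have hlow := h.inv_le_prod_abs_one_sub hk hkN
    have hQ₀ : 0 < Q := lt_of_lt_of_le (by positivity) hlow
    rw [← inv_pow]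
    gcongr
    exact inv_le_of_inv_le₀ (by positivity) hlow
  rw [Lagrange.basis, map_prod, norm_prod, ← Finset.prod_pow,
    range_succ_erase_eq_insert (by lia), Finset.prod_insert (by simp), sq_norm_aeval_basisDivisor,
    Finset.prod_congr rfl hfactor, Finset.prod_mul_distrib, Finset.prod_inv_distrib,
    Finset.prod_pow]
  calc _ ≤ (τ ^ 2 + B ^ 2) / c ^ 2 * ((Real.exp 5 * Real.exp (Real.pi * √(2 * (|τ| / c)))) *
        (2 * (k * (k + 2))) ^ 2) := by
        gcongr
        exact h.prod_one_add_div_sq_le_exp hc k N τ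
    _ = _ := by ring

end QuadraticSpectrum

end Interpolation

section Compactness

variable {H ι : Type*} [NormedAddCommGroup H] [InnerProductSpace ℝ H] [CompleteSpace H]

-- Weak-* compactness of balls in the dual of `H`.
theorem exists_inner_eq_of_forall_finset (e : ι → H) (a : ι → ℝ) (M : ℝ)
    (h : ∀ s : Finset ι, ∃ q : H, ‖q‖ ≤ M ∧ ∀ j ∈ s, inner ℝ q (e j) = a j) :
    ∃ q : H, ‖q‖ ≤ M ∧ ∀ j, inner ℝ q (e j) = a j := by
  obtain ⟨φ, hφ, hφe⟩ := (WeakDual.isCompact_closedBall (𝕜 := ℝ) (E := H) 0 M).inter_iInter_nonempty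
    (fun j => {φ : WeakDual ℝ H | φ (e j) = a j})
    (fun j => isClosed_eq (WeakDual.eval_continuous (e j)) continuous_const) fun s => by
      obtain ⟨q, hq, hqe⟩ := h s
      refine ⟨StrongDual.toWeakDual (InnerProductSpace.toDual ℝ H q), by simpa using hq, ?_⟩
      simpa using hqe
  refine ⟨(InnerProductSpace.toDual ℝ H).symm (WeakDual.toStrongDual φ), by simpa using hφ,
    fun j => ?_⟩
  rw [InnerProductSpace.toDual_symm_apply]
  exact mem_iInter.1 hφe j

end Compactness

section Decay

variable {β ν κ ρ c B D τ : ℝ}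

theorem one_add_pow_mul_exp_neg_le {η : ℝ} (hη : 0 < η) (hρ : 0 ≤ ρ) (n : ℕ) :
    (1 + ρ) ^ n * Real.exp (-(η * ρ)) ≤ n.factorial / η ^ n * Real.exp η := by
  have h := Real.pow_div_factorial_le_exp (η * (1 + ρ)) (by positivity) n
  rw [div_le_iff₀ (by positivity), mul_pow, mul_one_add, Real.exp_add] at h
  rw [Real.exp_neg, ← div_eq_mul_inv, div_le_iff₀ (Real.exp_pos _), div_mul_eq_mul_div,
    div_mul_eq_mul_div, le_div_iff₀ (by positivity)]
  linarith

theorem sub_one_div_add_one_le_sqrt_sub_one (hκ : 1 ≤ κ) : (κ - 1) / (κ + 1) ≤ √κ - 1 := by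
  have : 1 ≤ √κ := Real.one_le_sqrt.2 hκ
  have hsq : √κ ^ 2 = κ := Real.sq_sqrt (by linarith)
  rw [div_le_iff₀ (by linarith)]
  nlinarith [mul_nonneg (Real.sqrt_nonneg κ) (sq_nonneg (√κ - 1)), congrArg (√κ * ·) hsq]

theorem one_add_pow_mul_exp_decay_le (hκ : 1 < κ) (hρ : 0 ≤ ρ) (n : ℕ) :
    (1 + ρ) ^ n * ((1 + √κ * ρ) * Real.exp (-(√κ * ρ))) ^ 2 * Real.exp (2 * ρ) ≤
      κ ^ 2 * ((n + 2).factorial / (2 * ((κ - 1) / (κ + 1))) ^ (n + 2) * Real.exp 2) := by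
  set η := (κ - 1) / (κ + 1)
  have : 0 < η := div_pos (by linarith) (by linarith)
  have hη₁ : η ≤ 1 := (div_le_one (by linarith)).2 (by linarith)
  have hηκ : η ≤ √κ - 1 := sub_one_div_add_one_le_sqrt_sub_one hκ.le
  have hsqrt : √κ ≤ κ := Real.sqrt_le_iff.2 ⟨by linarith, by nlinarith⟩
  have hlinear : 1 + √κ * ρ ≤ κ * (1 + ρ) := by nlinarith
  have hexp : Real.exp (-(√κ * ρ)) ^ 2 * Real.exp (2 * ρ) ≤ Real.exp (-(2 * η * ρ)) := by
    rw [← Real.exp_nat_mul, ← Real.exp_add, Real.exp_le_exp]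
    push_cast
    nlinarith
  calc _ = (1 + ρ) ^ n * (1 + √κ * ρ) ^ 2 * (Real.exp (-(√κ * ρ)) ^ 2 * Real.exp (2 * ρ)) := by
        ring
    _ ≤ (1 + ρ) ^ n * (κ * (1 + ρ)) ^ 2 * Real.exp (-(2 * η * ρ)) := by gcongr
    _ = κ ^ 2 * ((1 + ρ) ^ (n + 2) * Real.exp (-(2 * η * ρ))) := by ring
    _ ≤ κ ^ 2 * ((n + 2).factorial / (2 * η) ^ (n + 2) * Real.exp (2 * η)) :=
        mul_le_mul_of_nonneg_left (one_add_pow_mul_exp_neg_le (by positivity) hρ (n + 2))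
          (sq_nonneg κ)
    _ ≤ _ := by
        gcongr
        linarith

theorem sq_add_sq_le_mul_one_add_pow {b : ℝ} (hρ : 0 ≤ ρ) (hτ : |τ| = b * ρ ^ 2) (B : ℝ) :
    τ ^ 2 + B ^ 2 ≤ (b ^ 2 + B ^ 2) * (1 + ρ) ^ 4 := by
  have hpow : ρ ^ 4 ≤ (1 + ρ) ^ 4 := by
    gcongr
    linarith
  have hone : 1 ≤ (1 + ρ) ^ 4 := one_le_pow₀ (by linarith)
  rw [← sq_abs τ, hτ, mul_pow, ← pow_mul, add_mul]
  exact add_le_add (mul_le_mul_of_nonneg_left hpow (sq_nonneg b))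
    (le_mul_of_one_le_right (sq_nonneg B) hone)

theorem exists_rescaled_frequency (hc : 0 < c) (hκ : 0 ≤ κ)
    (hβν : β * ν = κ * Real.pi ^ 2 / (2 * c)) (τ : ℝ) :
    ∃ ρ, 0 ≤ ρ ∧ |τ| = 2 * c / Real.pi ^ 2 * ρ ^ 2 ∧ Real.pi * √(2 * (|τ| / c)) = 2 * ρ ∧
      √(β * ν * |τ|) = √κ * ρ := by
  have hρ : 0 ≤ Real.pi * √(2 * (|τ| / c)) / 2 := by positivity
  have hτ : |τ| = 2 * c / Real.pi ^ 2 * (Real.pi * √(2 * (|τ| / c)) / 2) ^ 2 := by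
    rw [div_pow, mul_pow, Real.sq_sqrt (by positivity)]
    field_simp
  refine ⟨_, hρ, hτ, by ring, ?_⟩
  generalize Real.pi * √(2 * (|τ| / c)) / 2 = ρ at hρ hτ ⊢
  rw [show β * ν * |τ| = κ * ρ ^ 2 by rw [hβν, hτ]; field_simp, Real.sqrt_mul hκ,
    Real.sqrt_sq hρ]

/-- The constant bounding `(1 + τ²)` times the squared Fourier transform of the unnormalised
biorthogonal functions, up to `exp (-ν / 2)` and the interpolation constants. -/
def transformConst (β κ c B : ℝ) : ℝ :=
  4 * β ^ 2 * Real.exp 15 * (κ ^ 2 * ((((2 * c / Real.pi ^ 2) ^ 2 + B ^ 2) *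
    ((2 * c / Real.pi ^ 2) ^ 2 + 1)) *
      ((Nat.factorial 10 : ℝ) / (2 * ((κ - 1) / (κ + 1))) ^ 10)))

theorem transformConst_nonneg (hκ : 1 < κ) : 0 ≤ transformConst β κ c B := by
  have : 0 < (κ - 1) / (κ + 1) := div_pos (by linarith) (by linarith)
  unfold transformConst
  positivity

-- With `|τ|` of order `ρ²`, the transform of the bump decays like `exp (-√κ ρ)`, while the
-- interpolation polynomial grows like `exp ρ`.
theorem sq_mul_norm_laplace_bump_le (hβ : 0 < β) (hν : 0 < ν) (hκ : 1 < κ) (hc : 0 < c)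
    (hβν : β * ν = κ * Real.pi ^ 2 / (2 * c)) {A : ℝ}
    (hA : A ^ 2 ≤ (τ ^ 2 + B ^ 2) / c ^ 2 * D ^ 2 *
      (Real.exp 5 * Real.exp (Real.pi * √(2 * (|τ| / c))))) :
    (A * ‖laplace (bump β ν) (τ * Complex.I)‖) ^ 2 ≤
      (D / c) ^ 2 * Real.exp (-(ν / 4)) ^ 2 * transformConst β κ c B * (1 + τ ^ 2)⁻¹ := by
  obtain ⟨ρ, hρ, hτ, hgrowth, hsqrt⟩ := exists_rescaled_frequency hc (by linarith) hβν τ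
  have hF := norm_laplace_bump_le hβ hν τ
  have hF₀ := norm_nonneg (laplace (bump β ν) (τ * Complex.I))
  have hB := sq_add_sq_le_mul_one_add_pow hρ hτ B
  have hone := sq_add_sq_le_mul_one_add_pow hρ hτ 1
  have hdecay := one_add_pow_mul_exp_decay_le hκ hρ 8
  rw [hsqrt, mul_assoc (Real.exp 4)] at hF
  rw [hgrowth] at hA
  rw [← div_eq_mul_inv, le_div_iff₀ (by positivity), transformConst]
  set F := ‖laplace (bump β ν) (τ * Complex.I)‖
  set G := (1 + √κ * ρ) * Real.exp (-(√κ * ρ))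
  set b := 2 * c / Real.pi ^ 2
  have hexp : Real.exp 15 = Real.exp 5 * Real.exp 4 ^ 2 * Real.exp 2 := by
    rw [← Real.exp_nat_mul, ← Real.exp_add, ← Real.exp_add]
    norm_num
  calc (A * F) ^ 2 * (1 + τ ^ 2) = A ^ 2 * F ^ 2 * (τ ^ 2 + 1 ^ 2) := by ring
    _ ≤ ((b ^ 2 + B ^ 2) * (1 + ρ) ^ 4 / c ^ 2 * D ^ 2 * (Real.exp 5 * Real.exp (2 * ρ))) *
        (2 * β * Real.exp (-(ν / 4)) * (Real.exp 4 * G)) ^ 2 *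
          ((b ^ 2 + 1 ^ 2) * (1 + ρ) ^ 4) := by
      have hA' := hA.trans (show _ ≤ (b ^ 2 + B ^ 2) * (1 + ρ) ^ 4 / c ^ 2 * D ^ 2 *
        (Real.exp 5 * Real.exp (2 * ρ)) by gcongr)
      gcongr
    _ = (D / c) ^ 2 * Real.exp (-(ν / 4)) ^ 2 * (4 * β ^ 2 * (Real.exp 5 * Real.exp 4 ^ 2)) *
        ((b ^ 2 + B ^ 2) * (b ^ 2 + 1)) * ((1 + ρ) ^ 8 * G ^ 2 * Real.exp (2 * ρ)) := by
      rw [div_pow]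
      ring
    _ ≤ (D / c) ^ 2 * Real.exp (-(ν / 4)) ^ 2 * (4 * β ^ 2 * (Real.exp 5 * Real.exp 4 ^ 2)) *
        ((b ^ 2 + B ^ 2) * (b ^ 2 + 1)) * (κ ^ 2 * ((8 + 2).factorial /
          (2 * ((κ - 1) / (κ + 1))) ^ (8 + 2) * Real.exp 2)) := by gcongr
    _ = _ := by
      rw [hexp]
      norm_num only
      ring

end Decay

section Moments

variable {β ν c B κ T y : ℝ} {x μ : ℕ → ℝ} {k N : ℕ}

theorem inv_integral_exp_mul_bump_le (hβ : 0 < β) (hν : 0 < ν) (hy : 0 < y) :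
    (∫ t, Real.exp (y * t) * bump β ν t)⁻¹ ≤
      Real.exp 1 / (β / (2 * (ν + 2))) * Real.exp ν * (2 / (β / (2 * (ν + 2)) * y) ^ 2) := by
  have hlow := le_integral_exp_mul_bump hβ hν hy.le
  set d := β / (2 * (ν + 2))
  have hd₀ : 0 < d := by positivity
  have hquad : (d * y) ^ 2 / 2 ≤ Real.exp (y * d) := by
    simpa [mul_comm] using Real.pow_div_factorial_le_exp (d * y) (by positivity) 2
  have hle : d * ((d * y) ^ 2 / 2 * Real.exp (-(ν + 1))) ≤
      ∫ t, Real.exp (y * t) * bump β ν t := le_trans (by gcongr) hlow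
  refine (inv_anti₀ (by positivity) hle).trans_eq ?_
  rw [mul_inv, mul_inv, ← Real.exp_neg, neg_neg, Real.exp_add]
  field_simp

theorem sqrt_integral_sq_const_mul {a : ℝ} (ha : 0 ≤ a) (f : ℝ → ℝ) :
    √(∫ t, (a * f t) ^ 2) = a * √(∫ t, f t ^ 2) := by
  simp only [mul_pow]
  rw [integral_const_mul, Real.sqrt_mul (sq_nonneg a), Real.sqrt_sq ha]

/-- The parameter `ν` of the bump on `[-T / 2, T / 2]` for which its Fourier transform decays
`√κ` times as fast as the interpolation polynomials may grow. -/
def gevreyParam (c κ T : ℝ) : ℝ := κ * Real.pi ^ 2 / (c * T)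

/-- The coefficient of `(1 / μ k) * exp (3 * ν / 4)` in the bound on the `k`-th biorthogonal
function. -/
def momentConst (c B κ T : ℝ) : ℝ :=
  12 * Real.exp 1 * (1 + transformConst (T / 2) κ c B) /
    (c ^ 2 * (T / 2 / (2 * (gevreyParam c κ T + 2))) ^ 3)

theorem gevreyParam_pos (hc : 0 < c) (hκ : 0 < κ) (hT : 0 < T) : 0 < gevreyParam c κ T := by
  unfold gevreyParam
  positivity

namespace QuadraticSpectrum

theorem mul_sq_lt_eigenvalue (h : QuadraticSpectrum c x μ) (hc : 0 < c) (hk : 1 ≤ k) :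
    c * k ^ 2 < μ k := by
  have := h.lt_root hk
  rw [h.eq_mul_sq hk]
  gcongr

theorem exists_unnormalized_biorthogonal (h : QuadraticSpectrum c x μ) (hc : 0 < c)
    (hB : |μ 0| ≤ B) (hκ : 1 < κ) (hT : 0 < T) (hk : 1 ≤ k) (hkN : k ≤ N) :
    ∃ r, IsTestFunction (T / 2) r ∧
      (∀ j ≤ N, ∫ t, Real.exp (μ j * t) * r t =
        if j = k then ∫ t, Real.exp (μ k * t) * bump (T / 2) (gevreyParam c κ T) t else 0) ∧
      √(∫ t, r t ^ 2) ≤ 2 * (k * (k + 2)) / c * Real.exp (-(gevreyParam c κ T / 4)) *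
        (1 + transformConst (T / 2) κ c B) := by
  have hβ : 0 < T / 2 := by positivity
  have hν := gevreyParam_pos hc (by linarith : 0 < κ) hT
  have hβν : T / 2 * gevreyParam c κ T = κ * Real.pi ^ 2 / (2 * c) := by
    unfold gevreyParam
    field_simp
  have hK : 0 ≤ transformConst (T / 2) κ c B := transformConst_nonneg hκ
  obtain ⟨r, hr, hlaplace⟩ := (isTestFunction_bump hβ hν).exists_laplace_eq_aeval_mul
    (Lagrange.basis (Finset.range (N + 1)) μ k)
  refine ⟨r, hr, fun j hj => ?_, ?_⟩
  · have hz := hlaplace (μ j)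
    rw [laplace_ofReal, laplace_ofReal, ← Complex.coe_algebraMap,
      Polynomial.aeval_algebraMap_apply_eq_algebraMap_eval, Complex.coe_algebraMap,
      ← Complex.ofReal_mul, Complex.ofReal_inj] at hz
    rw [hz]
    split_ifs with hjk
    · rw [hjk, Lagrange.eval_basis_self (h.strictMono hc).injective.injOn (by simp; lia), one_mul]
    · rw [Lagrange.eval_basis_of_ne (Ne.symm hjk) (by simp; lia), zero_mul]
  · have hint := hr.integral_sq_le fun τ => by
      rw [hlaplace, norm_mul]
      exact sq_mul_norm_laplace_bump_le hβ hν hκ hc hβν (h.sq_norm_aeval_basis_le hc hB hk hkN τ)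
    refine Real.sqrt_le_iff.2 ⟨by positivity, hint.trans ?_⟩
    rw [← mul_pow, mul_pow _ (1 + _), mul_div_assoc]
    gcongr
    nlinarith

theorem exists_finite_biorthogonal (h : QuadraticSpectrum c x μ) (hc : 0 < c) (hB : |μ 0| ≤ B)
    (hκ : 1 < κ) (hT : 0 < T) (hk : 1 ≤ k) (hkN : k ≤ N) :
    ∃ q, IsTestFunction (T / 2) q ∧
      (∀ j ≤ N, ∫ t, Real.exp (μ j * t) * q t = if j = k then 1 else 0) ∧
      √(∫ t, q t ^ 2) ≤
        momentConst c B κ T * (1 / μ k) * Real.exp (3 / 4 * gevreyParam c κ T) := by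
  obtain ⟨r, hr, hmoment, hnorm⟩ := h.exists_unnormalized_biorthogonal hc hB hκ hT hk hkN
  have hν := gevreyParam_pos hc (by linarith : 0 < κ) hT
  have hμ := h.eigenvalue_pos hc hk
  have hinv := inv_integral_exp_mul_bump_le (half_pos hT) hν hμ
  have hI₀ : 0 < ∫ t, Real.exp (μ k * t) * bump (T / 2) (gevreyParam c κ T) t :=
    lt_of_lt_of_le (by positivity) (le_integral_exp_mul_bump (half_pos hT) hν hμ.le)
  rw [momentConst]
  set I := ∫ t, Real.exp (μ k * t) * bump (T / 2) (gevreyParam c κ T) t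
  set ν := gevreyParam c κ T
  set d := T / 2 / (2 * (ν + 2))
  have hd₀ : 0 < d := by positivity
  have hK : 0 ≤ transformConst (T / 2) κ c B := transformConst_nonneg hκ
  refine ⟨fun t => I⁻¹ * r t, hr.const_mul I⁻¹, fun j hj => ?_, ?_⟩
  · simp only [mul_left_comm (Real.exp _)]
    rw [integral_const_mul, hmoment j hj]
    split_ifs
    · exact inv_mul_cancel₀ hI₀.ne'
    · exact mul_zero _
  · have hD : (2 * (k * (k + 2)) : ℝ) ≤ 6 * μ k / c := by
      have hk' : (1 : ℝ) ≤ k := by exact_mod_cast hk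
      rw [le_div_iff₀ hc]
      nlinarith [h.mul_sq_lt_eigenvalue hc hk, mul_le_mul_of_nonneg_left hk' hc.le]
    have hexp : Real.exp (3 / 4 * ν) = Real.exp ν * Real.exp (-(ν / 4)) := by
      rw [← Real.exp_add]
      ring_nf
    calc √(∫ t, (I⁻¹ * r t) ^ 2) = I⁻¹ * √(∫ t, r t ^ 2) :=
        sqrt_integral_sq_const_mul (inv_pos.2 hI₀).le r
      _ ≤ (Real.exp 1 / d * Real.exp ν * (2 / (d * μ k) ^ 2)) *
          (6 * μ k / c / c * Real.exp (-(ν / 4)) * (1 + transformConst (T / 2) κ c B)) :=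
        mul_le_mul hinv (hnorm.trans (by gcongr)) (Real.sqrt_nonneg _) (by positivity)
      _ = _ := by
        rw [hexp]
        field_simp
        norm_num

end QuadraticSpectrum

end Moments

section Hilbert

variable {c B κ T : ℝ} {x μ : ℕ → ℝ} {k : ℕ} {f q : ℝ → ℝ}

theorem memLp_Ioo_of_continuous (T : ℝ) (hf : Continuous f) :
    MemLp f 2 (volume.restrict (Ioo (-(T / 2)) (T / 2))) := by
  obtain ⟨C, hC⟩ := (isCompact_Icc (a := -(T / 2)) (b := T / 2)).exists_bound_of_continuousOn
    hf.continuousOn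
  refine MemLp.of_bound hf.aestronglyMeasurable C ?_
  filter_upwards [ae_restrict_mem measurableSet_Ioo] with t ht
  exact hC t (Ioo_subset_Icc_self ht)

/-- The restriction of a continuous function to `(-T / 2, T / 2)`, as an element of `L²`. -/
def toL2Sym (T : ℝ) (hf : Continuous f) : L2Sym T := (memLp_Ioo_of_continuous T hf).toLp

theorem inner_toL2Sym (g : L2Sym T) (hf : Continuous f) :
    inner ℝ g (toL2Sym T hf) = ∫ t in Ioo (-(T / 2)) (T / 2), f t * g t := by
  rw [L2.inner_def]
  refine integral_congr_ae ?_
  filter_upwards [(memLp_Ioo_of_continuous T hf).coeFn_toLp] with t ht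
  rw [toL2Sym, ht]
  simp

theorem IsTestFunction.inner_toL2Sym_toL2Sym (hq : IsTestFunction (T / 2) q) (hf : Continuous f) :
    inner ℝ (toL2Sym T hq.contDiff.continuous) (toL2Sym T hf) = ∫ t, f t * q t := by
  have hcongr : ∫ t in Ioo (-(T / 2)) (T / 2), f t * toL2Sym T hq.contDiff.continuous t =
      ∫ t in Ioo (-(T / 2)) (T / 2), f t * q t := by
    refine integral_congr_ae ?_
    filter_upwards [(memLp_Ioo_of_continuous T hq.contDiff.continuous).coeFn_toLp] with t ht
    rw [toL2Sym, ht]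
  rw [inner_toL2Sym, hcongr, ← integral_Icc_eq_integral_Ioo]
  exact setIntegral_eq_integral_of_forall_compl_eq_zero fun t ht => by rw [hq.eq_zero ht, mul_zero]

theorem IsTestFunction.norm_toL2Sym (hq : IsTestFunction (T / 2) q) :
    ‖toL2Sym T hq.contDiff.continuous‖ = √(∫ t, q t ^ 2) := by
  rw [norm_eq_sqrt_real_inner, hq.inner_toL2Sym_toL2Sym]
  simp only [sq]

theorem QuadraticSpectrum.exists_biorthogonal (h : QuadraticSpectrum c x μ) (hc : 0 < c)
    (hB : |μ 0| ≤ B) (hκ : 1 < κ) (hT : 0 < T) (hk : 1 ≤ k) :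
    ∃ q : L2Sym T,
      ‖q‖ ≤ momentConst c B κ T * (1 / μ k) * Real.exp (3 / 4 * gevreyParam c κ T) ∧
      ∀ j, ∫ t in Ioo (-(T / 2)) (T / 2), Real.exp (μ j * t) * q t = if j = k then 1 else 0 := by
  have hexp (j : ℕ) : Continuous fun t => Real.exp (μ j * t) := by fun_prop
  simp only [← inner_toL2Sym _ (hexp _)]
  refine exists_inner_eq_of_forall_finset _ _ _ fun s => ?_
  obtain ⟨q, hq, hmoment, hnorm⟩ :=
    h.exists_finite_biorthogonal hc hB hκ hT hk (le_max_right (s.sup id) k)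
  refine ⟨toL2Sym T hq.contDiff.continuous, hq.norm_toL2Sym.trans_le hnorm, fun j hj => ?_⟩
  rw [hq.inner_toL2Sym_toL2Sym]
  exact hmoment j ((Finset.le_sup (f := id) hj).trans (le_max_left _ _))

end Hilbert

section Cost

variable {ε κ L T : ℝ}

/-- The rational function bounding the biorthogonal family of the viscous shock operator. -/
def costConst (ε κ L T : ℝ) : ℝ :=
  momentConst (gapConst ε L) (1 / (4 * ε) + gapConst ε L) κ T

theorem gevreyParam_gapConst (hε : ε ≠ 0) (hL : L ≠ 0) (κ T : ℝ) :
    gevreyParam (gapConst ε L) κ T = 4 * κ * L ^ 2 / (ε * T) := by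
  have := Real.pi_ne_zero
  unfold gevreyParam gapConst
  field_simp

theorem exists_isBiorthogonal_norm_le (hε : 0 < ε) (hκ : 1 < κ) (hL : 0 < L) (hT : 0 < T) :
    ∃ q : ℕ → L2Sym T, IsBiorthogonal ε L T q ∧ ∀ k : ℕ, 1 ≤ k →
      ‖q k‖ ≤ costConst ε κ L T * (1 / shiftedEigenval ε L k) *
        Real.exp (3 * κ * L ^ 2 / (ε * T)) := by
  obtain ⟨x, hx⟩ := exists_quadraticSpectrum hε hL
  choose! q hnorm hmoment using fun (k : ℕ) (hk : 1 ≤ k) =>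
    hx.exists_biorthogonal (gapConst_pos hε hL) (abs_shiftedEigenval_zero_le hε hL) hκ hT hk
  refine ⟨q, fun j k hk => hmoment k hk j, fun k hk => ?_⟩
  have hexponent : 3 / 4 * gevreyParam (gapConst ε L) κ T = 3 * κ * L ^ 2 / (ε * T) := by
    rw [gevreyParam_gapConst hε.ne' hL.ne']
    ring
  rw [← hexponent]
  exact hnorm k hk

end Cost

section Rational

/-- `f` agrees on `s` with a rational function whose denominator does not vanish on `s`. -/
def IsRationalOn {σ K : Type*} [Field K] (s : Set (σ → K)) (f : (σ → K) → K) : Prop :=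
  ∃ P Q : MvPolynomial σ K, ∀ v ∈ s,
    MvPolynomial.eval v Q ≠ 0 ∧ f v = MvPolynomial.eval v P / MvPolynomial.eval v Q

namespace IsRationalOn

section Field

variable {σ K : Type*} [Field K] {s : Set (σ → K)} {f g : (σ → K) → K}

theorem const (a : K) : IsRationalOn s fun _ => a :=
  ⟨MvPolynomial.C a, 1, fun v _ => by simp⟩

theorem coord (i : σ) : IsRationalOn s fun v => v i :=
  ⟨MvPolynomial.X i, 1, fun v _ => by simp⟩

theorem add (hf : IsRationalOn s f) (hg : IsRationalOn s g) :
    IsRationalOn s fun v => f v + g v := by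
  obtain ⟨P, Q, hPQ⟩ := hf
  obtain ⟨P', Q', hPQ'⟩ := hg
  refine ⟨P * Q' + Q * P', Q * Q', fun v hv => ?_⟩
  obtain ⟨hQ, hfv⟩ := hPQ v hv
  obtain ⟨hQ', hgv⟩ := hPQ' v hv
  simp only [map_mul, map_add]
  exact ⟨mul_ne_zero hQ hQ', by rw [hfv, hgv, div_add_div _ _ hQ hQ']⟩

theorem mul (hf : IsRationalOn s f) (hg : IsRationalOn s g) :
    IsRationalOn s fun v => f v * g v := by
  obtain ⟨P, Q, hPQ⟩ := hf
  obtain ⟨P', Q', hPQ'⟩ := hg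
  refine ⟨P * P', Q * Q', fun v hv => ?_⟩
  obtain ⟨hQ, hfv⟩ := hPQ v hv
  obtain ⟨hQ', hgv⟩ := hPQ' v hv
  simp only [map_mul]
  exact ⟨mul_ne_zero hQ hQ', by rw [hfv, hgv, div_mul_div_comm]⟩

theorem inv (hf : IsRationalOn s f) (hf₀ : ∀ v ∈ s, f v ≠ 0) : IsRationalOn s fun v => (f v)⁻¹ := by
  obtain ⟨P, Q, hPQ⟩ := hf
  refine ⟨Q, P, fun v hv => ?_⟩
  obtain ⟨-, hfv⟩ := hPQ v hv
  have hPQ₀ := hf₀ v hv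
  rw [hfv] at hPQ₀
  exact ⟨(div_ne_zero_iff.1 hPQ₀).1, (congrArg Inv.inv hfv).trans (inv_div _ _)⟩

theorem div (hf : IsRationalOn s f) (hg : IsRationalOn s g) (hg₀ : ∀ v ∈ s, g v ≠ 0) :
    IsRationalOn s fun v => f v / g v := by
  simpa only [div_eq_mul_inv] using hf.mul (hg.inv hg₀)

theorem pow (hf : IsRationalOn s f) (n : ℕ) : IsRationalOn s fun v => f v ^ n := by
  induction n with
  | zero => simpa only [pow_zero] using const 1
  | succ n ih => simpa only [pow_succ] using ih.mul hf

theorem sub (hf : IsRationalOn s f) (hg : IsRationalOn s g) :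
    IsRationalOn s fun v => f v - g v := by
  simpa only [neg_one_mul, ← sub_eq_add_neg] using hf.add ((const (-1)).mul hg)

end Field

variable {σ : Type*} {s : Set (σ → ℝ)} {β ε L κ c B T : (σ → ℝ) → ℝ}

theorem gapConst (hε : IsRationalOn s ε) (hL : IsRationalOn s L) (hL₀ : ∀ v ∈ s, 0 < L v) :
    IsRationalOn s fun v => gapConst (ε v) (L v) := by
  refine ((const (Real.pi ^ 2)).mul hε).div ((const 4).mul (hL.pow 2)) fun v hv => ?_
  have := hL₀ v hv
  positivity

theorem gevreyParam (hc : IsRationalOn s c) (hκ : IsRationalOn s κ) (hT : IsRationalOn s T)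
    (hc₀ : ∀ v ∈ s, 0 < c v) (hT₀ : ∀ v ∈ s, 0 < T v) :
    IsRationalOn s fun v => gevreyParam (c v) (κ v) (T v) :=
  (hκ.mul (const _)).div (hc.mul hT) fun v hv => (mul_pos (hc₀ v hv) (hT₀ v hv)).ne'

theorem transformConst (hβ : IsRationalOn s β) (hκ : IsRationalOn s κ) (hc : IsRationalOn s c)
    (hB : IsRationalOn s B) (hκ₁ : ∀ v ∈ s, 1 < κ v) :
    IsRationalOn s fun v => transformConst (β v) (κ v) (c v) (B v) := by
  have hratio : IsRationalOn s fun v => (κ v - 1) / (κ v + 1) :=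
    (hκ.sub (const 1)).div (hκ.add (const 1)) fun v hv => by linarith [hκ₁ v hv]
  have hc' : IsRationalOn s fun v => (2 * c v / Real.pi ^ 2) ^ 2 :=
    (((const 2).mul hc).div (const _) fun _ _ => pow_ne_zero 2 Real.pi_ne_zero).pow 2
  refine (((const 4).mul (hβ.pow 2)).mul (const _)).mul ((hκ.pow 2).mul
    (((hc'.add (hB.pow 2)).mul (hc'.add (const 1))).mul
      ((const _).div (((const 2).mul hratio).pow 10) fun v hv => ?_)))
  have : 0 < (κ v - 1) / (κ v + 1) := div_pos (by linarith [hκ₁ v hv]) (by linarith [hκ₁ v hv])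
  positivity

theorem momentConst (hc : IsRationalOn s c) (hB : IsRationalOn s B) (hκ : IsRationalOn s κ)
    (hT : IsRationalOn s T) (hc₀ : ∀ v ∈ s, 0 < c v) (hκ₁ : ∀ v ∈ s, 1 < κ v)
    (hT₀ : ∀ v ∈ s, 0 < T v) :
    IsRationalOn s fun v => momentConst (c v) (B v) (κ v) (T v) := by
  have hν : ∀ v ∈ s, 0 < BurgersShock.gevreyParam (c v) (κ v) (T v) := fun v hv =>
    gevreyParam_pos (hc₀ v hv) (zero_lt_one.trans (hκ₁ v hv)) (hT₀ v hv)
  have hβ : IsRationalOn s fun v => T v / 2 := hT.div (const 2) fun _ _ => two_ne_zero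
  have hd := hβ.div ((const 2).mul ((hc.gevreyParam hκ hT hc₀ hT₀).add (const 2))) fun v hv =>
    (mul_pos two_pos (add_pos (hν v hv) two_pos)).ne'
  refine ((const _).mul ((const 1).add (hβ.transformConst hκ hc hB hκ₁))).div
    ((hc.pow 2).mul (hd.pow 3)) fun v hv => ?_
  have := hν v hv
  have := hc₀ v hv
  have := hT₀ v hv
  positivity

end IsRationalOn

theorem isRationalOn_costConst :
    IsRationalOn {v : Fin 4 → ℝ | 0 < v 0 ∧ 1 < v 1 ∧ 0 < v 2 ∧ 0 < v 3}
      fun v => costConst (v 0) (v 1) (v 2) (v 3) := by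
  set s := {v : Fin 4 → ℝ | 0 < v 0 ∧ 1 < v 1 ∧ 0 < v 2 ∧ 0 < v 3}
  have hgap : IsRationalOn s fun v => gapConst (v 0) (v 2) :=
    .gapConst (.coord 0) (.coord 2) fun v hv => hv.2.2.1
  have hbound : IsRationalOn s fun v => 1 / (4 * v 0) + gapConst (v 0) (v 2) :=
    .add (.div (.const 1) (.mul (.const 4) (.coord 0)) fun v hv =>
      mul_ne_zero four_ne_zero hv.1.ne') hgap
  exact hgap.momentConst hbound (.coord 1) (.coord 3) (fun v hv => gapConst_pos hv.1 hv.2.2.1)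
    (fun v hv => hv.2.1) fun v hv => hv.2.2.2

end Rational

end

end BurgersShock

theorem lemma3p4 :
    (∀ ε L T : ℝ, 0 < ε → 0 < L → 0 < T →
      ∃ q : ℕ → BurgersShock.L2Sym T, BurgersShock.IsBiorthogonal ε L T q) ∧
    ∃ P Q : MvPolynomial (Fin 4) ℝ,
      ∀ ε κ L T : ℝ, 0 < ε → 1 < κ → 0 < L → 0 < T →
        MvPolynomial.eval ![ε, κ, L, T] Q ≠ 0 ∧
        ∃ q : ℕ → BurgersShock.L2Sym T,
          BurgersShock.IsBiorthogonal ε L T q ∧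
          ∀ k : ℕ, 1 ≤ k →
            ‖q k‖ ≤ MvPolynomial.eval ![ε, κ, L, T] P / MvPolynomial.eval ![ε, κ, L, T] Q *
              (1 / BurgersShock.shiftedEigenval ε L k) *
              Real.exp (3 * κ * L ^ 2 / (ε * T)) := by
  refine ⟨fun ε L T hε hL hT => ?_, ?_⟩
  · obtain ⟨q, hq, -⟩ := BurgersShock.exists_isBiorthogonal_norm_le hε one_lt_two hL hT
    exact ⟨q, hq⟩
  · obtain ⟨P, Q, hPQ⟩ := BurgersShock.isRationalOn_costConst
    refine ⟨P, Q, fun ε κ L T hε hκ hL hT => ?_⟩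
    obtain ⟨hQ, hP⟩ := hPQ ![ε, κ, L, T] ⟨hε, hκ, hL, hT⟩
    refine ⟨hQ, ?_⟩
    rw [← hP]
    exact BurgersShock.exists_isBiorthogonal_norm_le hε hκ hL hT
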